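/- **Setting.** Let $G$ be a second countable locally compact (Hausdorff) group, $S$ a closed subgroup, $H=G/S$, with left Haar measures $dg$, $ds$ and modular functions $\Delta_G,\Delta_S$ (normalized by $\int_G f(gh)\,dg=\Delta_G(h)^{-1}\int_G f(g)\,dg$, and likewise on $S$); put $\Delta_{G,S}=\Delta_G|_S/\Delta_S$. Let $\sigma:H\to G$ be a Borel cross-section ($\sigma(x)\in x$ for all $x$) mapping compact sets to relatively compact sets. Write $\tau(g)=\sigma(gS)^{-1}g\in S$, so that $g=\sigma(gS)\tau(g)$, and let $dx$ be the unique Borel measure on $H$ with $$\int_G f(g)\,dg=\int_H\int_S f(\sigma(x)s)\,\Delta_{G,S}(s)\,ds\,dx\qquad\text{for all Borel } f\ge 0 .$$ Let $\rho$ be a strongly continuous isometric representation of $S$ on a complex Banach space $X$. Let $X_0\subset X$ be a dense $\rho$-invariant subspace with an injective antilinear map $i:X_0\to X^*$ such that, with $\langle x,v\rangle:=i(v)(x)$, one has $\|x\|=\sup\{|\langle x,v\rangle| : v\in X_0,\ \|i(v)\|=1\}$, $\|i(\rho(s)v)\|=\|i(v)\|$ and $\langle\rho(s)x,\rho(s)v\rangle=\langle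 x,v\rangle$ for all $x\in X$, $v\in X_0$, $s\in S$ (a supremum over the empty set being $0$). Let $1\le p<\infty$ and $\frac1p+\frac1{p'}=1$. The $p$-induced representation $\pi_p$ of $G$, realized on functions $\xi$ on $H$, is $$[\pi_p(g)\xi](y)=\Delta_{G,S}(t)^{-1/p}\,\rho(t^{-1})\,[\xi(g^{-1}y)],\qquad t=\tau(g^{-1}\sigma(y)).$$ For $1\le r\le\infty$ and $\phi:S\to\mathbb C$ put $$[\xi\otimes^r_\rho\phi](\sigma(x)s)=\phi(s)\,\Delta_{G,S}(s)^{-1/r}\,\rho(s^{-1})[\xi(x)],\qquad x\in H,\ s\in S,$$ and $[\lambda_G(g)F](h)=F(g^{-1}h)$. Pairings of functions are $\langle f,h\rangle=\int\langle f(z),h(z)\rangle\,dz$, over $H$ with $dx$ or over $G$ with $dg$. **Proposition.** Let $S$ be amenable. Let $\xi,\eta:H\to X_0$ be compactly supported and continuous for the norm of $X$, and let $i\circ\eta:H\to X^*$ also be norm continuous. Then: (a) There is an increasing sequence $(A_j)$ of compact subsets of $S$ of positive Haar measure with $A_j^{-1}=A_j$ and $\bigcup_j A_j=S$ such that, for all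 $1\le r<\infty$ with conjugate exponent $r'$, the convolutions $\dfrac{\chi_{A_j}}{|A_j|^{1/r}}*\dfrac{\chi_{A_j}}{|A_j|^{1/r'}}$ tend to $1$ uniformly on compact subsets of $S$ (here $(\phi*\psi)(t)=\int_S\phi(s)\psi(s^{-1}t)\,ds$). (b) For every such sequence, with $\phi_j=\chi_{A_j}/|A_j|^{1/p}$ and $\psi_j=\chi_{A_j}/|A_j|^{1/p'}$, the integrals defining the pairings below converge absolutely for all $g\in G$ and all $j$, and $$\langle\pi_p(g)\xi,\eta\rangle=\lim_{j\to\infty}\big\langle\lambda_G(g)(\xi\otimes^p_\rho\phi_j),\ \eta\otimes^{p'}_\rho\psi_j\big\rangle$$ uniformly for $g$ in compact subsets of $G$. -/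

import Mathlib

set_option linter.unusedSectionVars false

open MeasureTheory Filter Topology
open scoped NNReal ENNReal BoundedContinuousFunction

namespace PInduced

/-! ### Amenability -/

section Amenable

variable {M : Type*} [Group M] [TopologicalSpace M] [IsTopologicalGroup M]

/-- The left translate `x ↦ f (s⁻¹ x)` of a bounded continuous function. -/
noncomputable def leftTranslate (s : M) (f : M →ᵇ ℝ) : M →ᵇ ℝ :=
  f.compContinuous ⟨fun x => s⁻¹ * x, continuous_const_mul s⁻¹⟩

variable (M) in
/-- `M` is amenable: there is a left-invariant mean (a positive normalized left-invariant linear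
functional) on the bounded continuous functions on `M`. -/
def IsAmenable : Prop :=
  ∃ m : (M →ᵇ ℝ) →ₗ[ℝ] ℝ, m 1 = 1 ∧ (∀ f, 0 ≤ f → 0 ≤ m f) ∧
    ∀ (s : M) (f : M →ᵇ ℝ), m (leftTranslate s f) = m f

end Amenable

/-! ### Modular functions -/

section Modular

variable {M : Type*} [Group M] [TopologicalSpace M] [IsTopologicalGroup M] [LocallyCompactSpace M]

/-- The modular function, normalized by `∫ f (x h) dx = Δ(h)⁻¹ ∫ f (x) dx` for left Haar measures
(Mathlib's character is the inverse of this one). -/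
noncomputable def modFun (h : M) : ℝ≥0 := (Measure.modularCharacterFun h)⁻¹

/-- The normalization of the modular function. -/
theorem lintegral_mul_right_modFun [SecondCountableTopology M] [MeasurableSpace M] [BorelSpace M]
    (μ : Measure M) [μ.IsHaarMeasure] {f : M → ℝ≥0∞} (hf : Measurable f) (h : M) :
    ∫⁻ x, f (x * h) ∂μ = ((modFun h)⁻¹ : ℝ≥0) * ∫⁻ x, f x ∂μ := by
  have h1 : μ.map (· * h) = Measure.modularCharacterFun h • μ := by
    rw [Measure.modularCharacterFun_eq_haarScalarFactor μ]
    exact Measure.isMulLeftInvariant_eq_smul _ μ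
  rw [← lintegral_map hf (measurable_mul_const h), h1, lintegral_smul_measure, modFun, inv_inv]
  rfl

theorem modFun_mul (g h : M) : modFun (g * h) = modFun g * modFun h := by
  simp [modFun, Measure.modularCharacterFun_map_mul, mul_comm]

theorem modFun_ne_zero (g : M) : modFun g ≠ 0 :=
  inv_ne_zero (Measure.modularCharacterFun_pos g).ne'

theorem measurable_modFun [T2Space M] [SecondCountableTopology M] [MeasurableSpace M]
    [BorelSpace M] : Measurable (modFun : M → ℝ≥0) := by
  obtain ⟨K⟩ : Nonempty (TopologicalSpace.PositiveCompacts M) := inferInstance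
  let μ : Measure M := Measure.haar
  have hK : MeasurableSet (K : Set M) := K.isCompact.measurableSet
  have h0 : μ K ≠ 0 := (Measure.measure_pos_of_nonempty_interior μ K.interior_nonempty).ne'
  have ht : μ K ≠ ⊤ := K.isCompact.measure_lt_top.ne
  have h1 : Measurable fun h : M => ∫⁻ x, (K : Set M).indicator (1 : M → ℝ≥0∞) (x * h) ∂μ := by
    have h : Measurable fun p : M × M => (K : Set M).indicator (1 : M → ℝ≥0∞) (p.1 * p.2) :=
      (measurable_one.indicator hK).comp (measurable_fst.mul measurable_snd)
    exact h.lintegral_prod_left'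
  have h2 : ∀ h : M, (modFun h)⁻¹ =
      ((∫⁻ x, (K : Set M).indicator (1 : M → ℝ≥0∞) (x * h) ∂μ) / μ K).toNNReal := by
    intro h
    rw [lintegral_mul_right_modFun μ (measurable_one.indicator hK) h, lintegral_indicator_one hK,
      ENNReal.mul_div_cancel_right h0 ht, ENNReal.toNNReal_coe]
  have h3 : Measurable fun h : M => (modFun h)⁻¹ := by
    simp_rw [h2]
    exact (h1.div_const _).ennreal_toNNReal
  have h4 := h3.inv
  have h5 : (fun h : M => (modFun h)⁻¹)⁻¹ = modFun := by ext; simp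
  rwa [h5] at h4

end Modular

/-! ### Cross-sections and the measure on the quotient -/

section Quotient

variable {G : Type*} [Group G] [TopologicalSpace G] [IsTopologicalGroup G]
  [LocallyCompactSpace G] [T2Space G] [SecondCountableTopology G]
  [MeasurableSpace G] [BorelSpace G]

instance locallyCompactSpace_of_isClosed (S : Subgroup G) [hS : IsClosed (S : Set G)] :
    LocallyCompactSpace S :=
  hS.isClosedEmbedding_subtypeVal.locallyCompactSpace

instance secondCountable_subgroup (S : Subgroup G) : SecondCountableTopology S :=
  TopologicalSpace.Subtype.secondCountableTopology (S : Set G)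

/-- A Borel cross-section `σ : G ⧸ S → G`, mapping compact sets to relatively compact sets. -/
structure CrossSection (S : Subgroup G) where
  toFun : G ⧸ S → G
  measurable' : @Measurable (G ⧸ S) G (borel (G ⧸ S)) _ toFun
  mk_toFun : ∀ x : G ⧸ S, ((toFun x : G) : G ⧸ S) = x
  relCompact : ∀ K : Set (G ⧸ S), IsCompact K → IsCompact (closure (toFun '' K))

variable {S : Subgroup G}

/-- The `S`-component `τ(g) = σ(gS)⁻¹ g`, so that `g = σ(gS) τ(g)`. -/
def CrossSection.tau (σ : CrossSection S) (g : G) : S :=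
  ⟨(σ.toFun (g : G ⧸ S))⁻¹ * g, QuotientGroup.eq.1 (σ.mk_toFun g)⟩

theorem CrossSection.tau_mul (σ : CrossSection S) (g : G) (s : S) :
    σ.tau (g * s) = σ.tau g * s := by
  ext
  simp [CrossSection.tau, QuotientGroup.mk_mul_of_mem g s.2, mul_assoc]

theorem CrossSection.section_mul_tau (σ : CrossSection S) (g : G) :
    σ.toFun (g : G ⧸ S) * σ.tau g = g := by
  simp [CrossSection.tau]

theorem CrossSection.tau_section (σ : CrossSection S) (x : G ⧸ S) : σ.tau (σ.toFun x) = 1 := by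
  ext
  simp [CrossSection.tau, σ.mk_toFun x]

theorem CrossSection.borelSpace (σ : CrossSection S) : BorelSpace (G ⧸ S) := by
  refine ⟨le_antisymm ?_ ?_⟩
  · intro A hA
    have h1 : MeasurableSet ((fun g : G => (g : G ⧸ S)) ⁻¹' A) := measurableSet_quotient.1 hA
    have h2 := σ.measurable' h1
    have h3 : σ.toFun ⁻¹' ((fun g : G => (g : G ⧸ S)) ⁻¹' A) = A := by
      ext x
      simp [σ.mk_toFun x]
    rwa [h3] at h2
  · refine MeasurableSpace.generateFrom_le fun U hU => ?_
    exact measurableSet_quotient.2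
      ((show IsOpen U from hU).preimage QuotientGroup.continuous_mk).measurableSet

theorem CrossSection.measurable (σ : CrossSection S) : Measurable σ.toFun := by
  have := σ.measurable'
  rwa [← σ.borelSpace.measurable_eq] at this

theorem measurable_mk : Measurable fun g : G => (g : G ⧸ S) := measurable_quotient_mk''

theorem CrossSection.measurable_tau (σ : CrossSection S) : Measurable σ.tau :=
  (((σ.measurable.comp measurable_mk).inv).mul measurable_id).subtype_mk

variable [IsClosed (S : Set G)]

/-- `Δ_{G,S}(s) = Δ_G(s) / Δ_S(s)` for `s ∈ S`. -/
noncomputable def modRatio (s : S) : ℝ≥0 := modFun (s : G) / modFun s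

theorem modRatio_mul (s t : S) : modRatio (s * t) = modRatio s * modRatio t := by
  simp [modRatio, modFun_mul, mul_div_mul_comm]

theorem modRatio_ne_zero (s : S) : modRatio s ≠ 0 :=
  div_ne_zero (modFun_ne_zero _) (modFun_ne_zero _)

theorem measurable_modRatio : Measurable (modRatio : S → ℝ≥0) :=
  (measurable_modFun.comp measurable_subtype_coe).div measurable_modFun

/-- There is exactly one measure `dx` on `G ⧸ S` such that
`∫_G f(g) dg = ∫_{G/S} ∫_S f(σ(x) s) Δ_{G,S}(s) ds dx`. -/
theorem existsUnique_quotientMeasure (σ : CrossSection S)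
    (μG : Measure G) [μG.IsHaarMeasure] (μS : Measure S) [μS.IsHaarMeasure] :
    ∃! ν : Measure (G ⧸ S), ∀ f : G → ℝ≥0∞, Measurable f →
      ∫⁻ g, f g ∂μG = ∫⁻ x, ∫⁻ s : S, f (σ.toFun x * s) * (modRatio s : ℝ≥0∞) ∂μS ∂ν := by
  classical
  have := σ.borelSpace
  obtain ⟨C⟩ : Nonempty (TopologicalSpace.PositiveCompacts S) := inferInstance
  have hC : MeasurableSet (C : Set S) := C.isCompact.measurableSet
  have hc0 : μS C ≠ 0 := (Measure.measure_pos_of_nonempty_interior μS C.interior_nonempty).ne'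
  have hct : μS C ≠ ⊤ := C.isCompact.measure_lt_top.ne
  have hmG : Measurable fun s : S => modFun (s : G) := measurable_modFun.comp measurable_subtype_coe
  have hmR : Measurable (modRatio : S → ℝ≥0) := measurable_modRatio
  have hmS : Measurable (modFun : S → ℝ≥0) := measurable_modFun
  have hτ := σ.measurable_tau
  have hσ := σ.measurable
  have hmk : Measurable fun g : G => (g : G ⧸ S) := measurable_mk
  -- the weight
  let u : S → ℝ≥0 := (C : Set S).indicator 1
  have hu : Measurable u := measurable_one.indicator hC
  have hu_int : ∫⁻ s, (u s : ℝ≥0∞) ∂μS = μS C := by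
    rw [← lintegral_indicator_one hC]
    refine lintegral_congr fun s => ?_
    by_cases hs : s ∈ (C : Set S) <;> simp [u, hs]
  let w : S → ℝ≥0 := fun s => u s⁻¹ * modFun ((s⁻¹ : S) : G)
  have hw : Measurable w := (hu.comp measurable_inv).mul (hmG.comp measurable_inv)
  -- measurability of the fibre integrals
  have hF : ∀ f : G → ℝ≥0∞, Measurable f → Measurable fun x : G ⧸ S =>
      ∫⁻ s : S, f (σ.toFun x * s) * (modRatio s : ℝ≥0∞) ∂μS := by
    intro f hf
    have h : Measurable fun z : (G ⧸ S) × S =>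
        f (σ.toFun z.1 * z.2) * (modRatio z.2 : ℝ≥0∞) :=
      (hf.comp ((hσ.comp measurable_fst).mul (measurable_subtype_coe.comp measurable_snd))).mul
        (hmR.comp measurable_snd).coe_nnreal_ennreal
    exact h.lintegral_prod_right'
  have hJ : ∀ t : S, ∫⁻ s : S, (((modFun (s : G))⁻¹ * w (t * s⁻¹) * modRatio t : ℝ≥0) : ℝ≥0∞) ∂μS
      = μS C := by
    intro t
    have hL : Measurable fun s : S =>
        (((modFun (s : G))⁻¹ * w (t * s⁻¹) * modRatio t : ℝ≥0) : ℝ≥0∞) :=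
      ((hmG.inv.mul (hw.comp (measurable_const.mul measurable_inv))).mul_const _).coe_nnreal_ennreal
    have h1 := lintegral_mul_right_modFun μS hL t
    have h2 : ∀ s : S, (((modFun ((s * t : S) : G))⁻¹ * w (t * (s * t)⁻¹) * modRatio t : ℝ≥0) : ℝ≥0∞)
        = ((modFun t)⁻¹ : ℝ≥0) * (u s : ℝ≥0∞) := by
      intro s
      rw [← ENNReal.coe_mul, ENNReal.coe_inj]
      have e1 : t * (s * t)⁻¹ = s⁻¹ := by group
      have e2 : modFun ((s * t : S) : G) = modFun (s : G) * modFun (t : G) := by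
        rw [Subgroup.coe_mul, modFun_mul]
      have n1 := modFun_ne_zero (s : G)
      have n2 := modFun_ne_zero (t : G)
      have n3 := modFun_ne_zero t
      rw [e1, e2]
      simp only [w, inv_inv, modRatio]
      field_simp
    simp_rw [h2] at h1
    rw [lintegral_const_mul _ hu.coe_nnreal_ennreal, hu_int] at h1
    have h3 : (((modFun t)⁻¹ : ℝ≥0) : ℝ≥0∞) ≠ 0 := by
      simpa using modFun_ne_zero t
    exact ((ENNReal.mul_right_inj h3 ENNReal.coe_ne_top).1 h1).symm
  refine existsUnique_of_exists_of_unique ?_ ?_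
  · refine ⟨(μS C)⁻¹ • (μG.withDensity fun g => (w (σ.tau g) : ℝ≥0∞)).map
      (fun g : G => (g : G ⧸ S)), fun f hf => ?_⟩
    have hwτ : Measurable fun g => (w (σ.tau g) : ℝ≥0∞) := (hw.comp hτ).coe_nnreal_ennreal
    have hFm : Measurable fun g : G =>
        ∫⁻ s : S, f (σ.toFun (g : G ⧸ S) * s) * (modRatio s : ℝ≥0∞) ∂μS := (hF f hf).comp hmk
    rw [lintegral_smul_measure, lintegral_map (hF f hf) hmk,
      lintegral_withDensity_eq_lintegral_mul _ hwτ hFm]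
    have hA : ∀ g : G, ∫⁻ s : S, f (σ.toFun (g : G ⧸ S) * s) * (modRatio s : ℝ≥0∞) ∂μS =
        ∫⁻ s : S, f (g * s) * (modRatio (σ.tau g * s) : ℝ≥0∞) ∂μS := by
      intro g
      rw [← lintegral_mul_left_eq_self _ (σ.tau g)]
      refine lintegral_congr fun s => ?_
      rw [Subgroup.coe_mul, ← mul_assoc, σ.section_mul_tau]
    have hB : ∫⁻ g, ((fun g => (w (σ.tau g) : ℝ≥0∞)) * fun g : G =>
          ∫⁻ s : S, f (σ.toFun (g : G ⧸ S) * s) * (modRatio s : ℝ≥0∞) ∂μS) g ∂μG =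
        ∫⁻ g, ∫⁻ s : S, (w (σ.tau g) : ℝ≥0∞) * (f (g * s) * (modRatio (σ.tau g * s) : ℝ≥0∞))
          ∂μS ∂μG := by
      refine lintegral_congr fun g => ?_
      rw [Pi.mul_apply, hA, lintegral_const_mul]
      exact (hf.comp (measurable_const.mul measurable_subtype_coe)).mul
        (hmR.comp (measurable_const.mul measurable_id)).coe_nnreal_ennreal
    have hB' : ∫⁻ g, ∫⁻ s : S,
          (w (σ.tau g) : ℝ≥0∞) * (f (g * s) * (modRatio (σ.tau g * s) : ℝ≥0∞)) ∂μS ∂μG =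
        ∫⁻ s : S, ∫⁻ g,
          (w (σ.tau g) : ℝ≥0∞) * (f (g * s) * (modRatio (σ.tau g * s) : ℝ≥0∞)) ∂μG ∂μS := by
      refine lintegral_lintegral_swap (Measurable.aemeasurable ?_)
      exact (hwτ.comp measurable_fst).mul
        ((hf.comp (measurable_fst.mul (measurable_subtype_coe.comp measurable_snd))).mul
          (hmR.comp ((hτ.comp measurable_fst).mul measurable_snd)).coe_nnreal_ennreal)
    have hD : ∀ s : S, ∫⁻ g,
          (w (σ.tau g) : ℝ≥0∞) * (f (g * s) * (modRatio (σ.tau g * s) : ℝ≥0∞)) ∂μG =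
        ∫⁻ g, f g * (((modFun (s : G))⁻¹ * w (σ.tau g * s⁻¹) * modRatio (σ.tau g) : ℝ≥0) : ℝ≥0∞)
          ∂μG := by
      intro s
      have hH : Measurable fun g =>
          (w (σ.tau g * s⁻¹) : ℝ≥0∞) * (f g * (modRatio (σ.tau g) : ℝ≥0∞)) :=
        (hw.comp (hτ.mul_const _)).coe_nnreal_ennreal.mul
          (hf.mul (hmR.comp hτ).coe_nnreal_ennreal)
      have h1 := lintegral_mul_right_modFun μG hH (s : G)
      simp only [σ.tau_mul, mul_inv_cancel_right] at h1
      rw [h1, ← lintegral_const_mul _ hH]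
      refine lintegral_congr fun g => ?_
      push_cast
      ring
    have hE : ∫⁻ s : S, ∫⁻ g,
          f g * (((modFun (s : G))⁻¹ * w (σ.tau g * s⁻¹) * modRatio (σ.tau g) : ℝ≥0) : ℝ≥0∞)
            ∂μG ∂μS =
        ∫⁻ g, ∫⁻ s : S,
          f g * (((modFun (s : G))⁻¹ * w (σ.tau g * s⁻¹) * modRatio (σ.tau g) : ℝ≥0) : ℝ≥0∞)
            ∂μS ∂μG := by
      refine lintegral_lintegral_swap (Measurable.aemeasurable ?_)
      exact (hf.comp measurable_snd).mul
        (((hmG.comp measurable_fst).inv.mul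
          (hw.comp ((hτ.comp measurable_snd).mul measurable_fst.inv))).mul
          (hmR.comp (hτ.comp measurable_snd))).coe_nnreal_ennreal
    have hK : ∀ g, ∫⁻ s : S,
          f g * (((modFun (s : G))⁻¹ * w (σ.tau g * s⁻¹) * modRatio (σ.tau g) : ℝ≥0) : ℝ≥0∞) ∂μS
        = f g * μS C := by
      intro g
      rw [lintegral_const_mul, hJ]
      exact ((hmG.inv.mul
        (hw.comp (measurable_const.mul measurable_inv))).mul_const _).coe_nnreal_ennreal
    rw [hB, hB']
    simp_rw [hD]
    rw [hE]
    simp_rw [hK]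
    rw [lintegral_mul_const _ hf, smul_eq_mul, mul_comm (∫⁻ g, f g ∂μG), ← mul_assoc,
      ENNReal.inv_mul_cancel hc0 hct, one_mul]
  · have key : ∀ ν : Measure (G ⧸ S), (∀ f : G → ℝ≥0∞, Measurable f →
        ∫⁻ g, f g ∂μG =
          ∫⁻ x, ∫⁻ s : S, f (σ.toFun x * s) * (modRatio s : ℝ≥0∞) ∂μS ∂ν) →
        ∀ B : Set (G ⧸ S), MeasurableSet B → ν B = (∫⁻ g : G, B.indicator 1 (g : G ⧸ S) *
          (((u (σ.tau g)) * (modRatio (σ.tau g))⁻¹ : ℝ≥0) : ℝ≥0∞) ∂μG) / μS C := by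
      intro ν hν B hB
      have hm : Measurable fun g : G => (B.indicator 1 (g : G ⧸ S) : ℝ≥0∞) *
          (((u (σ.tau g)) * (modRatio (σ.tau g))⁻¹ : ℝ≥0) : ℝ≥0∞) :=
        ((measurable_one.indicator hB).comp hmk).mul
          ((hu.comp hτ).mul (hmR.comp hτ).inv).coe_nnreal_ennreal
      rw [hν _ hm]
      have h1 : ∀ (x : G ⧸ S), ∫⁻ s : S,
          (B.indicator 1 ((σ.toFun x * s : G) : G ⧸ S) : ℝ≥0∞) *
            (((u (σ.tau (σ.toFun x * s))) * (modRatio (σ.tau (σ.toFun x * s)))⁻¹ : ℝ≥0) : ℝ≥0∞) *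
            (modRatio s : ℝ≥0∞) ∂μS = B.indicator 1 x * μS C := by
        intro x
        rw [← hu_int, ← lintegral_const_mul _ hu.coe_nnreal_ennreal]
        refine lintegral_congr fun s => ?_
        rw [σ.tau_mul, σ.tau_section, one_mul, QuotientGroup.mk_mul_of_mem _ s.2, σ.mk_toFun,
          mul_assoc, ← ENNReal.coe_mul, inv_mul_cancel_right₀ (modRatio_ne_zero s)]
      simp_rw [h1]
      rw [lintegral_mul_const _ (measurable_one.indicator hB), lintegral_indicator_one hB,
        ENNReal.mul_div_cancel_right hc0 hct]
    intro ν ν' hν hν'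
    ext B hB
    rw [key ν hν B hB, key ν' hν' B hB]

/-- The measure `dx` on `G ⧸ S` determined by the cross-section and the two Haar measures through
`∫_G f(g) dg = ∫_{G/S} ∫_S f(σ(x) s) Δ_{G,S}(s) ds dx`. -/
noncomputable def quotientMeasure (σ : CrossSection S)
    (μG : Measure G) [μG.IsHaarMeasure] (μS : Measure S) [μS.IsHaarMeasure] : Measure (G ⧸ S) :=
  (existsUnique_quotientMeasure σ μG μS).choose

theorem lintegral_eq_quotientMeasure (σ : CrossSection S)
    (μG : Measure G) [μG.IsHaarMeasure] (μS : Measure S) [μS.IsHaarMeasure]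
    {f : G → ℝ≥0∞} (hf : Measurable f) :
    ∫⁻ g, f g ∂μG =
      ∫⁻ x, ∫⁻ s : S, f (σ.toFun x * s) * (modRatio s : ℝ≥0∞) ∂μS ∂(quotientMeasure σ μG μS) :=
  (existsUnique_quotientMeasure σ μG μS).choose_spec.1 f hf

/-! ### The induced representation and twisted tensor products -/

variable {V : Type*} [AddCommGroup V] [Module ℂ V]

/-- The `p`-covariant extension of `ξ : G ⧸ S → V` to `G`,
`ξ~(σ(x) s) = Δ_{G,S}(s)^{-1/p} ρ(s⁻¹) ξ(x)`; for `p = ∞` the exponent is `0`. -/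
noncomputable def covExt (σ : CrossSection S) (ρ : Representation ℂ S V) (p : ℝ≥0∞)
    (ξ : G ⧸ S → V) (g : G) : V :=
  (((modRatio (σ.tau g) : ℝ) ^ (-(p⁻¹).toReal) : ℝ) : ℂ) • ρ (σ.tau g)⁻¹ (ξ (g : G ⧸ S))

/-- The `p`-induced representation, realized on functions on `G ⧸ S` by means of the
cross-section: left translation of covariant functions on `G`, restricted to `σ(G ⧸ S)`. -/
noncomputable def inducedRep (σ : CrossSection S) (ρ : Representation ℂ S V) (p : ℝ≥0∞) (g : G)
    (ξ : G ⧸ S → V) (y : G ⧸ S) : V :=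
  covExt σ ρ p ξ (g⁻¹ * σ.toFun y)

/-- The `ρ`-twisted tensor product
`(ξ ⊗ φ)(σ(x) s) = φ(s) Δ_{G,S}(s)^{-1/p} ρ(s⁻¹) ξ(x)`. -/
noncomputable def twistedTensor (σ : CrossSection S) (ρ : Representation ℂ S V) (p : ℝ≥0∞)
    (ξ : G ⧸ S → V) (φ : S → ℂ) (g : G) : V :=
  φ (σ.tau g) • covExt σ ρ p ξ g

end Quotient

/-- Left translation of functions on `G`. -/
def leftReg {G V : Type*} [Group G] (g : G) (f : G → V) (h : G) : V := f (g⁻¹ * h)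

/-! ### The dual pairing -/

/-- A dense `ρ`-invariant subspace `X₀` of `X` with an injective antilinear map into the dual of
`X` that is norming for `X`, and compatible with `ρ`. -/
structure DualPairing {S X : Type*} [Group S] [NormedAddCommGroup X] [NormedSpace ℂ X]
    (ρ : Representation ℂ S X) where
  X₀ : Submodule ℂ X
  dense : Dense (X₀ : Set X)
  invariant : ∀ (s : S), ∀ v ∈ X₀, ρ s v ∈ X₀
  toDual : X₀ →ₛₗ[starRingEnd ℂ] (X →L[ℂ] ℂ)
  injective : Function.Injective toDual
  norm_eq : ∀ x : X, ‖x‖ = sSup {r : ℝ | ∃ v : X₀, ‖toDual v‖ = 1 ∧ r = ‖toDual v x‖}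
  norm_toDual : ∀ (s : S) (v : X₀), ‖toDual ⟨ρ s v, invariant s v v.2⟩‖ = ‖toDual v‖
  pair_inv : ∀ (s : S) (x : X) (v : X₀),
    toDual ⟨ρ s v, invariant s v v.2⟩ (ρ s x) = toDual v x

namespace DualPairing

variable {S X : Type*} [Group S] [NormedAddCommGroup X] [NormedSpace ℂ X]
  {ρ : Representation ℂ S X}

/-- The restriction of `ρ` to `X₀`. -/
def rep₀ (P : DualPairing ρ) : Representation ℂ S P.X₀ where
  toFun s := (ρ s).restrict (P.invariant s)
  map_one' := by ext; simp
  map_mul' s t := by ext; simp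

/-- The pairing `⟨f, h⟩ = ∫ ⟨f(z), h(z)⟩ dz` of an `X`-valued and an `X₀`-valued function. -/
noncomputable def pair (P : DualPairing ρ) {Z : Type*} [MeasurableSpace Z] (μ : Measure Z)
    (f : Z → X) (h : Z → P.X₀) : ℂ :=
  ∫ z, P.toDual (h z) (f z) ∂μ

/-- The integral defining the pairing converges absolutely. -/
def Pairable (P : DualPairing ρ) {Z : Type*} [MeasurableSpace Z] (μ : Measure Z)
    (f : Z → X) (h : Z → P.X₀) : Prop :=
  Integrable (fun z => P.toDual (h z) (f z)) μ

end DualPairing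

/-! ### Exhaustions by compact sets -/

/-- The indicator of `A`, normalized to have norm one in `L^p`: `χ_A / |A|^{1/p}`. -/
noncomputable def normInd {S : Type*} [MeasurableSpace S] (μ : Measure S) (p : ℝ≥0∞)
    (A : Set S) : S → ℂ :=
  A.indicator fun _ => (((μ.real A) ^ (-(p⁻¹).toReal) : ℝ) : ℂ)

/-- The convolution `(φ * ψ)(t) = ∫ φ(s) ψ(s⁻¹ t) ds`. -/
noncomputable def conv {S : Type*} [Group S] [MeasurableSpace S] (μ : Measure S)
    (φ ψ : S → ℂ) (t : S) : ℂ :=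
  ∫ s, φ s * ψ (s⁻¹ * t) ∂μ

/-- An increasing sequence of symmetric compact sets `A_j` of positive measure with union `S`,
such that, for all conjugate exponents `p < ∞` and `q`, the convolutions
`χ_{A_j} / |A_j|^{1/p} * χ_{A_j} / |A_j|^{1/q}` tend to `1` uniformly on compact sets. -/
structure IsExhaustion {S : Type*} [Group S] [TopologicalSpace S] [MeasurableSpace S]
    (μ : Measure S) (A : ℕ → Set S) : Prop where
  isCompact : ∀ j, IsCompact (A j)
  monotone : Monotone A
  symm : ∀ j, (fun s => s⁻¹) ⁻¹' A j = A j
  iUnion_eq : ⋃ j, A j = Set.univ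
  pos : ∀ j, 0 < μ (A j)
  tendsto : ∀ p q : ℝ≥0∞, p ≠ ⊤ → p.HolderConjugate q → ∀ K : Set S, IsCompact K →
    TendstoUniformlyOn (fun j t => conv μ (normInd μ p (A j)) (normInd μ q (A j)) t)
      (fun _ => 1) atTop K

end PInduced

/-! Write k_g(y) for the integrand of the pairing of π_p(g)ξ with η. By covariance, invariance of
the dual pairing under ρ, and 1/p + 1/q = 1, the integrand of the tensor pairing at σ(y)s equals
ψ(s) φ(ts) Δ_{G,S}(s)⁻¹ k_g(y), where t = τ(g⁻¹σ(y)) (`toDual_twistedTensor`). The integration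
formula on G supplies the factor Δ_{G,S}(s), and symmetry of A_j gives φ(ts) = φ(s⁻¹t⁻¹). Hence the
fibre integral is k_g(y) (ψ * φ)(t⁻¹) (`fiber_integral_tensorKernel`). For g in a compact set, k_g
is bounded by a constant on supp η, vanishes off it, and is nonzero only when t lies in a fixed
compact T ⊆ S (`exists_coeffKernel_bound`). Uniform convergence of the convolutions to 1 on T⁻¹
therefore gives uniform convergence of the pairings.

The remaining work is the exhaustion. For symmetric A the convolution at t is |tA ∩ A| / |A|,
whatever the exponents (`conv_normInd`), so increasing symmetric compact Følner sets are needed. An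
invariant mean on bounded continuous functions takes v * F to a multiple of ∫ v, by uniqueness of
Haar measure (`exists_mean_translateAverage`). Hahn–Banach separation then gives almost invariant
L¹-functions, uniformly over compact sets (`exists_reiter`). Truncation and the correlation x ↦ ∫
f(s) f(x⁻¹s) ds make them inversion invariant. A layer-cake argument selects a level set that is
almost invariant on average (`exists_symmetric_almost_invariant_average`), and a Chebyshev argument
makes this pointwise (`exists_symmetric_almost_invariant`). In a noncompact group such sets can have
arbitrarily large measure, so a prescribed compact set can be adjoined at negligible cost
(`exists_folner_superset`). -/

namespace PInduced

open CompactlySupported Measure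

/-! ### Invariant means and convolution. -/

section Mean

variable {M : Type*} [Group M] [TopologicalSpace M] [IsTopologicalGroup M]
  [LocallyCompactSpace M] [T2Space M] [SecondCountableTopology M]
  [MeasurableSpace M] [BorelSpace M]

theorem integrable_mul_translate (μ : Measure M) [μ.IsHaarMeasure] (v : C_c(M, ℝ))
    (F : M →ᵇ ℝ) (y : M) : Integrable (fun s => v s * F (s⁻¹ * y)) μ := by
  refine Continuous.integrable_of_hasCompactSupport (by fun_prop) ?_
  exact v.hasCompactSupport.mul_right

/-- The convolution `y ↦ ∫ v(s) F(s⁻¹ y) ds` as a bounded continuous function. -/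
noncomputable def translateAverage (μ : Measure M) [μ.IsHaarMeasure] (v : C_c(M, ℝ))
    (F : M →ᵇ ℝ) : M →ᵇ ℝ :=
  BoundedContinuousFunction.ofNormedAddCommGroup (fun y => ∫ s, v s * F (s⁻¹ * y) ∂μ)
    (by
      refine continuous_of_dominated (bound := fun s => ‖v s‖ * ‖F‖) (fun y => ?_) (fun y => ?_)
        ?_ ?_
      · exact (integrable_mul_translate μ v F y).aestronglyMeasurable
      · refine ae_of_all _ fun s => ?_
        rw [norm_mul]
        gcongr
        exact F.norm_coe_le_norm _
      · exact (v.continuous.integrable_of_hasCompactSupport v.hasCompactSupport).norm.mul_const _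
      · exact ae_of_all _ fun s => by fun_prop)
    ((∫ s, ‖v s‖ ∂μ) * ‖F‖)
    (by
      intro y
      rw [← integral_mul_const]
      refine norm_integral_le_of_norm_le
        ((v.continuous.integrable_of_hasCompactSupport v.hasCompactSupport).norm.mul_const _) ?_
      refine ae_of_all _ fun s => ?_
      rw [norm_mul]
      gcongr
      exact F.norm_coe_le_norm _)

theorem translateAverage_apply (μ : Measure M) [μ.IsHaarMeasure] (v : C_c(M, ℝ))
    (F : M →ᵇ ℝ) (y : M) : translateAverage μ v F y = ∫ s, v s * F (s⁻¹ * y) ∂μ := rfl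

/-- Left translation of compactly supported continuous functions. -/
def translateCc (t : M) (v : C_c(M, ℝ)) : C_c(M, ℝ) where
  toFun s := v (t⁻¹ * s)
  continuous_toFun := by fun_prop
  hasCompactSupport' := v.hasCompactSupport.comp_homeomorph (Homeomorph.mulLeft t⁻¹)

/-- Left translation of v left-translates v * F, so v ↦ m(v * F) is a positive left-invariant
functional on C_c. Its Riesz measure is then a multiple of Haar measure. This replaces the usual
passage to a topologically invariant mean on L^∞. -/
theorem mean_translateAverage_of_nonneg (μ : Measure M) [μ.IsHaarMeasure]
    {m : (M →ᵇ ℝ) →ₗ[ℝ] ℝ} (hpos : ∀ f, 0 ≤ f → 0 ≤ m f)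
    (hinv : ∀ (s : M) (f : M →ᵇ ℝ), m (leftTranslate s f) = m f) {F : M →ᵇ ℝ} (hF : 0 ≤ F) :
    ∃ c : ℝ, ∀ v : C_c(M, ℝ), m (translateAverage μ v F) = c * ∫ s, v s ∂μ := by
  let φ : C_c(M, ℝ) →ₗ[ℝ] ℝ :=
    { toFun := fun v => m (translateAverage μ v F)
      map_add' := fun v w => by
        rw [← map_add]
        congr 1
        ext y
        simp only [translateAverage_apply, BoundedContinuousFunction.add_apply,
          CompactlySupportedContinuousMap.add_apply, add_mul]
        exact integral_add (integrable_mul_translate μ v F y) (integrable_mul_translate μ w F y)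
      map_smul' := fun c v => by
        rw [← map_smul]
        congr 1
        ext y
        simp only [translateAverage_apply, BoundedContinuousFunction.smul_apply,
          CompactlySupportedContinuousMap.smul_apply, smul_eq_mul, mul_assoc, RingHom.id_apply]
        exact integral_const_mul _ _ }
  have hφ : ∀ v, 0 ≤ v → 0 ≤ φ v := fun v hv => hpos _ fun y =>
    integral_nonneg fun s => mul_nonneg (hv s) (hF _)
  let Λ : C_c(M, ℝ) →ₚ[ℝ] ℝ := PositiveLinearMap.mk₀ φ hφ
  let ν := RealRMK.rieszMeasure Λ
  have hν : ∀ v : C_c(M, ℝ), ∫ s, v s ∂ν = m (translateAverage μ v F) :=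
    fun v => RealRMK.integral_rieszMeasure Λ v
  have htr : ∀ t v, m (translateAverage μ (translateCc t v) F) = m (translateAverage μ v F) := by
    intro t v
    rw [← hinv t (translateAverage μ v F)]
    congr 1
    ext y
    change ∫ s, v (t⁻¹ * s) * F (s⁻¹ * y) ∂μ = ∫ s, v s * F (s⁻¹ * (t⁻¹ * y)) ∂μ
    rw [← integral_mul_left_eq_self (fun s => v (t⁻¹ * s) * F (s⁻¹ * y)) t]
    simp [mul_assoc]
  have : ν.IsMulLeftInvariant := by
    refine ⟨fun t => ?_⟩
    have : (ν.map (t * ·)).Regular := Regular.map (Homeomorph.mulLeft t)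
    refine Measure.ext_of_integral_eq_on_compactlySupported fun v => ?_
    rw [integral_map (measurable_const_mul t).aemeasurable
      (f := v) v.continuous.aestronglyMeasurable, hν v, ← htr t⁻¹ v, ← hν]
    simp [translateCc]
  refine ⟨haarScalarFactor ν μ, fun v => ?_⟩
  rw [← hν, integral_isMulLeftInvariant_eq_smul_of_hasCompactSupport ν μ (f := v) v.continuous
    v.hasCompactSupport, integral_smul_nnreal_measure]
  rfl

/-- A left-invariant mean takes the convolution `v * F` to a multiple of `∫ v`. -/
theorem exists_mean_translateAverage (μ : Measure M) [μ.IsHaarMeasure]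
    {m : (M →ᵇ ℝ) →ₗ[ℝ] ℝ} (hpos : ∀ f, 0 ≤ f → 0 ≤ m f)
    (hinv : ∀ (s : M) (f : M →ᵇ ℝ), m (leftTranslate s f) = m f) (F : M →ᵇ ℝ) :
    ∃ c : ℝ, ∀ v : C_c(M, ℝ), m (translateAverage μ v F) = c * ∫ s, v s ∂μ := by
  obtain ⟨a, ha⟩ := mean_translateAverage_of_nonneg μ hpos hinv (F := F ⊔ 0) le_sup_right
  obtain ⟨b, hb⟩ := mean_translateAverage_of_nonneg μ hpos hinv (F := (-F) ⊔ 0) le_sup_right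
  refine ⟨a - b, fun v => ?_⟩
  rw [sub_mul, ← ha, ← hb, ← map_sub]
  congr 1
  ext y
  rw [BoundedContinuousFunction.sub_apply]
  simp only [translateAverage_apply]
  rw [← integral_sub (integrable_mul_translate μ v _ y) (integrable_mul_translate μ v _ y)]
  congr 1
  ext s
  rw [← mul_sub]
  congr 1
  simp only [BoundedContinuousFunction.coe_sup, Pi.sup_apply, BoundedContinuousFunction.coe_zero,
    Pi.zero_apply, BoundedContinuousFunction.coe_neg, Pi.neg_apply]
  exact (posPart_sub_negPart (F (s⁻¹ * y))).symm

end Mean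

end PInduced

namespace PInduced

open CompactlySupported Measure
open scoped Pointwise

/-! ### Continuity of the modular function and right translation. -/

section ModularContinuity

variable {M : Type*} [Group M] [TopologicalSpace M] [IsTopologicalGroup M]
  [LocallyCompactSpace M] [T2Space M] [SecondCountableTopology M]
  [MeasurableSpace M] [BorelSpace M]

theorem map_mul_right_eq_modularCharacterFun_smul (μ : Measure M) [μ.IsHaarMeasure] (t : M) :
    μ.map (· * t) = modularCharacterFun t • μ := by
  rw [modularCharacterFun_eq_haarScalarFactor μ]
  exact isMulLeftInvariant_eq_smul _ μ

theorem integral_mul_right_eq_modularCharacterFun {E : Type*} [NormedAddCommGroup E]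
    [NormedSpace ℝ E] (μ : Measure M) [μ.IsHaarMeasure] (f : M → E) (t : M) :
    ∫ s, f (s * t) ∂μ = modularCharacterFun t • ∫ s, f s ∂μ := by
  rw [← integral_smul_nnreal_measure, ← map_mul_right_eq_modularCharacterFun_smul]
  exact ((Homeomorph.mulRight t).measurableEmbedding.integral_map f).symm

/-- Provides the common compact support required for continuity of integrals of right translates in
the parameter t. -/
theorem eventually_comp_mul_right_eq_zero (v : C_c(M, ℝ)) (t₀ : M) :
    ∃ V ∈ 𝓝 t₀, ∃ k : Set M, IsCompact k ∧ ∀ t ∈ V, ∀ s ∉ k, v (s * t) = 0 := by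
  obtain ⟨V, hV, hV'⟩ := exists_compact_mem_nhds t₀
  refine ⟨V, hV', tsupport v * V⁻¹, v.hasCompactSupport.mul hV.inv, fun t ht s hs => ?_⟩
  by_contra h
  exact hs ⟨s * t, subset_tsupport _ h, t⁻¹, Set.inv_mem_inv.2 ht, by simp⟩

theorem continuous_modularCharacterFun : Continuous (modularCharacterFun : M → ℝ≥0) := by
  let μ : Measure M := haar
  obtain ⟨g, hgc, hg0, hg1⟩ := exists_continuous_nonneg_pos (1 : M)
  have hpos := g.2.integral_pos_of_hasCompactSupport_nonneg_nonzero (μ := μ) hgc hg0 hg1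
  have h1 : ∀ t, (modularCharacterFun t : ℝ) = (∫ s, g (s * t) ∂μ) / ∫ s, g s ∂μ := fun t => by
    rw [integral_mul_right_eq_modularCharacterFun μ (fun s => g s), NNReal.smul_def, smul_eq_mul]
    exact (mul_div_cancel_right₀ _ hpos.ne').symm
  rw [NNReal.isEmbedding_coe.continuous_iff]
  refine continuous_iff_continuousAt.2 fun t₀ => ?_
  obtain ⟨V, hV, k, hk, hk0⟩ := eventually_comp_mul_right_eq_zero ⟨g, hgc⟩ t₀
  have h2 : ContinuousOn (fun t => (∫ s, g (s * t) ∂μ) / ∫ s, g s ∂μ) V :=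
    (continuousOn_integral_of_compact_support hk
      (Continuous.continuousOn (by unfold Function.uncurry; fun_prop))
      (fun t s ht hs => hk0 t ht s hs)).div_const _
  exact (h2.continuousAt hV).congr (Eventually.of_forall fun t => (h1 t).symm)

theorem continuous_modFun : Continuous (modFun : M → ℝ≥0) :=
  continuous_modularCharacterFun.inv₀ fun t => (modularCharacterFun_pos t).ne'

/-- Right translation of compactly supported continuous functions, normalized to preserve the
integral against left Haar measure. -/
noncomputable def rightTranslateCc (t : M) (v : C_c(M, ℝ)) : C_c(M, ℝ) where
  toFun s := (modularCharacterFun t : ℝ)⁻¹ * v (s * t)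
  continuous_toFun := by fun_prop
  hasCompactSupport' := (v.hasCompactSupport.comp_homeomorph (Homeomorph.mulRight t)).mul_left

theorem rightTranslateCc_apply (t : M) (v : C_c(M, ℝ)) (s : M) :
    rightTranslateCc t v s = (modularCharacterFun t : ℝ)⁻¹ * v (s * t) := rfl

theorem integral_rightTranslateCc (μ : Measure M) [μ.IsHaarMeasure] (t : M) (v : C_c(M, ℝ)) :
    ∫ s, rightTranslateCc t v s ∂μ = ∫ s, v s ∂μ := by
  simp_rw [rightTranslateCc_apply]
  rw [integral_const_mul, integral_mul_right_eq_modularCharacterFun μ (fun s => v s),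
    NNReal.smul_def, smul_eq_mul, inv_mul_cancel_left₀]
  exact_mod_cast (modularCharacterFun_pos t).ne'

theorem tendsto_rightTranslateCc (μ : Measure M) [μ.IsHaarMeasure] (v : C_c(M, ℝ)) :
    Tendsto (fun t => ∫ s, ‖rightTranslateCc t v s - v s‖ ∂μ) (𝓝 1) (𝓝 0) := by
  obtain ⟨V, hV, k, hk, hk0⟩ := eventually_comp_mul_right_eq_zero v 1
  have hc : ContinuousOn (fun t => ∫ s, ‖rightTranslateCc t v s - v s‖ ∂μ) V := by
    refine continuousOn_integral_of_compact_support
      (f := fun t s => ‖rightTranslateCc t v s - v s‖) (hk.union v.hasCompactSupport) ?_ ?_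
    · refine Continuous.continuousOn ?_
      have h1 : Continuous fun p : M × M => ((modularCharacterFun p.1 : ℝ))⁻¹ :=
        (NNReal.continuous_coe.comp (continuous_modularCharacterFun.comp continuous_fst)).inv₀
          fun p => NNReal.coe_ne_zero.2 (modularCharacterFun_pos p.1).ne'
      have h2 : Continuous fun p : M × M => v (p.2 * p.1) := by fun_prop
      have h3 : Continuous fun p : M × M => v p.2 := by fun_prop
      exact ((h1.mul h2).sub h3).norm
    · intro t s ht hs
      rw [Set.mem_union, not_or] at hs
      rw [rightTranslateCc_apply, hk0 t ht s hs.1, image_eq_zero_of_notMem_tsupport hs.2]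
      simp
  have h := (hc.continuousAt hV).tendsto
  simpa [rightTranslateCc_apply, modularCharacterFun_map_one] using h

end ModularContinuity

/-! ### Reiter's condition from an invariant mean. -/

section Reiter

variable {M : Type*} [Group M] [TopologicalSpace M] [IsTopologicalGroup M]
  [LocallyCompactSpace M] [T2Space M] [SecondCountableTopology M]
  [MeasurableSpace M] [BorelSpace M] (μ : Measure M) [μ.IsHaarMeasure]

/-- Left translation on `L¹` as a continuous linear map. -/
noncomputable def shift (t : M) : Lp ℝ 1 μ →L[ℝ] Lp ℝ 1 μ where
  toFun f := DomMulAct.mk t⁻¹ • f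
  map_add' := DomMulAct.smul_Lp_add _
  map_smul' c f := smul_comm _ c f
  cont := continuous_const_smul _

theorem shift_mul (s t : M) (f : Lp ℝ 1 μ) : shift μ (s * t) f = shift μ s (shift μ t f) := by
  simp only [shift, ContinuousLinearMap.coe_mk', LinearMap.coe_mk, AddHom.coe_mk, smul_smul,
    ← DomMulAct.mk_mul, mul_inv_rev]

theorem norm_shift (t : M) (f : Lp ℝ 1 μ) : ‖shift μ t f‖ = ‖f‖ := DomMulAct.norm_smul_Lp _ _

theorem shift_ae_eq (t : M) (f : Lp ℝ 1 μ) : shift μ t f =ᵐ[μ] fun x => f (t⁻¹ * x) :=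
  DomMulAct.smul_Lp_ae_eq _ _

theorem continuous_shift (f : Lp ℝ 1 μ) : Continuous fun t => shift μ t f := by
  have : Fact ((1 : ℝ≥0∞) ≠ ⊤) := ⟨ENNReal.one_ne_top⟩
  have h : Continuous fun t : M => DomMulAct.mk t⁻¹ :=
    DomMulAct.continuous_mk.comp continuous_inv
  exact h.smul continuous_const

theorem integral_shift (t : M) (f : Lp ℝ 1 μ) : ∫ x, shift μ t f x ∂μ = ∫ x, f x ∂μ := by
  rw [integral_congr_ae (shift_ae_eq μ t f)]
  exact integral_mul_left_eq_self (fun x => f x) t⁻¹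

/-- The convolution of `v`, the point mass at `y`, and `e`, up to inversion: the `L¹`-function
`∫ v(s) (s⁻¹ y) • e ds`. -/
noncomputable def smear (e : Lp ℝ 1 μ) (v : C_c(M, ℝ)) (y : M) : Lp ℝ 1 μ :=
  ∫ s, v s • shift μ (s⁻¹ * y) e ∂μ

theorem integrable_smear (e : Lp ℝ 1 μ) (v : C_c(M, ℝ)) (y : M) :
    Integrable (fun s => v s • shift μ (s⁻¹ * y) e) μ := by
  refine Continuous.integrable_of_hasCompactSupport ?_ v.hasCompactSupport.smul_right
  exact v.continuous.smul ((continuous_shift μ e).comp (by fun_prop))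

theorem smear_sub (e : Lp ℝ 1 μ) (v w : C_c(M, ℝ)) (y : M) :
    smear μ e (v - w) y = smear μ e v y - smear μ e w y := by
  rw [smear, smear, smear, ← integral_sub (integrable_smear μ e v y) (integrable_smear μ e w y)]
  simp [sub_smul]

theorem norm_smear_le (e : Lp ℝ 1 μ) (v : C_c(M, ℝ)) (y : M) :
    ‖smear μ e v y‖ ≤ (∫ s, ‖v s‖ ∂μ) * ‖e‖ := by
  rw [← integral_mul_const]
  refine (norm_integral_le_integral_norm _).trans_eq ?_
  simp_rw [norm_smul, norm_shift]

/-- The substitution s ↦ st moves the translation onto v, independently of y. This yields both the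
cancellation under the mean and a modulus of continuity uniform over the convex hull of all smears.
-/
theorem shift_smear (e : Lp ℝ 1 μ) (v : C_c(M, ℝ)) (t y : M) :
    shift μ t (smear μ e v y) = smear μ e (rightTranslateCc t v) y := by
  rw [smear, smear, ← ContinuousLinearMap.integral_comp_comm _ (integrable_smear μ e v y)]
  simp_rw [map_smul, ← shift_mul, rightTranslateCc_apply, mul_smul]
  rw [integral_smul]
  have h := integral_mul_right_eq_modularCharacterFun μ
    (fun s => v s • shift μ (t * (s⁻¹ * y)) e) t
  simp only [mul_inv_rev, mul_assoc, mul_inv_cancel_left] at h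
  rw [h, NNReal.smul_def, inv_smul_smul₀]
  exact_mod_cast (modularCharacterFun_pos t).ne'

/-- Matrix coefficients of translation on `L¹`. -/
noncomputable def shiftCoeff (e : Lp ℝ 1 μ) (l : StrongDual ℝ (Lp ℝ 1 μ)) : M →ᵇ ℝ :=
  BoundedContinuousFunction.ofNormedAddCommGroup (fun y => l (shift μ y e))
    (l.continuous.comp (continuous_shift μ e)) (‖l‖ * ‖e‖)
    (fun y => (l.le_opNorm _).trans_eq (by rw [norm_shift]))

theorem dual_smear (e : Lp ℝ 1 μ) (l : StrongDual ℝ (Lp ℝ 1 μ)) (v : C_c(M, ℝ)) (y : M) :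
    l (smear μ e v y) = translateAverage μ v (shiftCoeff μ e l) y := by
  rw [smear, ← ContinuousLinearMap.integral_comp_comm _ (integrable_smear μ e v y)]
  simp [translateAverage_apply, shiftCoeff]

theorem integral_smear (e : Lp ℝ 1 μ) (v : C_c(M, ℝ)) (y : M) :
    ∫ x, smear μ e v y x ∂μ = (∫ s, v s ∂μ) * ∫ x, e x ∂μ := by
  rw [← L1.integral_eq_integral, L1.integral_eq, smear,
    ← ContinuousLinearMap.integral_comp_comm _ (integrable_smear μ e v y), ← integral_mul_const]
  congr 1
  ext s
  rw [map_smul, ← L1.integral_eq, L1.integral_eq_integral, integral_shift, smul_eq_mul]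

/-- If 0 were not in the closure of the tuples (tf - f) over t ∈ T, a functional would exceed some u
> 0 on all of them. Along y ↦ `smear μ e v y` this gives a bounded continuous function F ≥ u, so its
mean is at least u. But F is a sum of differences of averages with weights of equal integral, so its
mean is 0. -/
theorem exists_finset_reiter (hM : IsAmenable M) (e : Lp ℝ 1 μ) (v : C_c(M, ℝ)) (T : Finset M)
    {ε : ℝ} (hε : 0 < ε) :
    ∃ f ∈ convexHull ℝ (Set.range (smear μ e v)), ∀ t ∈ T, ‖shift μ t f - f‖ < ε := by
  classical
  obtain ⟨m, m1, hpos, hinv⟩ := hM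
  let D : Lp ℝ 1 μ →L[ℝ] (T → Lp ℝ 1 μ) :=
    ContinuousLinearMap.pi fun t => shift μ (t : M) - ContinuousLinearMap.id ℝ _
  let C : Set (T → Lp ℝ 1 μ) := D '' convexHull ℝ (Set.range (smear μ e v))
  have hC : Convex ℝ C := (convex_convexHull ℝ _).linear_image D.toLinearMap
  suffices h0 : (0 : T → Lp ℝ 1 μ) ∈ closure C by
    obtain ⟨_, ⟨f, hf, rfl⟩, hfε⟩ := Metric.mem_closure_iff.1 h0 ε hε
    refine ⟨f, hf, fun t ht => ?_⟩
    rw [dist_zero_left] at hfε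
    exact (norm_le_pi_norm (D f) ⟨t, ht⟩).trans_lt hfε
  by_contra h0
  obtain ⟨Λ, u, hu0, hu⟩ := geometric_hahn_banach_point_closed hC.closure isClosed_closure h0
  rw [map_zero] at hu0
  let l : T → StrongDual ℝ (Lp ℝ 1 μ) := fun t =>
    Λ.comp (ContinuousLinearMap.single ℝ (fun _ : T => Lp ℝ 1 μ) t)
  have hΛ : ∀ w, Λ w = ∑ t, l t (w t) := fun w => by
    conv_lhs => rw [← Finset.univ_sum_single w]
    rw [_root_.map_sum]
    rfl
  let F : M →ᵇ ℝ := ∑ t : T, (translateAverage μ (rightTranslateCc (t : M) v) (shiftCoeff μ e (l t))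
    - translateAverage μ v (shiftCoeff μ e (l t)))
  have hF : ∀ y, F y = Λ (D (smear μ e v y)) := fun y => by
    rw [hΛ]
    simp only [F, BoundedContinuousFunction.coe_sum, Finset.sum_apply,
      BoundedContinuousFunction.coe_sub, Pi.sub_apply]
    refine Finset.sum_congr rfl fun t _ => ?_
    rw [← dual_smear, ← dual_smear, ← shift_smear, ← map_sub]
    rfl
  have hmF : m F = 0 := by
    simp only [F, _root_.map_sum, map_sub]
    refine Finset.sum_eq_zero fun t _ => ?_
    obtain ⟨c, hc⟩ := exists_mean_translateAverage μ hpos hinv (shiftCoeff μ e (l t))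
    rw [hc, hc, integral_rightTranslateCc, sub_self]
  have h2 : 0 ≤ m (F - u • 1) := hpos _ fun y => by
    have := hu (D (smear μ e v y)) (subset_closure ⟨_, subset_convexHull ℝ _ ⟨y, rfl⟩, rfl⟩)
    rw [← hF] at this
    simpa using this.le
  rw [map_sub, map_smul, hmF, m1] at h2
  simp at h2
  linarith

/-- Reiter's condition: an amenable group has almost invariant `L¹`-functions. -/
theorem exists_reiter (hM : IsAmenable M) {K : Set M} (hK : IsCompact K) {ε : ℝ} (hε : 0 < ε) :
    ∃ f : Lp ℝ 1 μ, 1 ≤ ‖f‖ ∧ ∀ t ∈ K, ‖shift μ t f - f‖ < ε := by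
  obtain ⟨g, hgc, hg0, hg1⟩ := exists_continuous_nonneg_pos (1 : M)
  have hpos := g.2.integral_pos_of_hasCompactSupport_nonneg_nonzero (μ := μ) hgc hg0 hg1
  let v : C_c(M, ℝ) := (∫ s, g s ∂μ)⁻¹ • ⟨g, hgc⟩
  have hv : ∫ s, v s ∂μ = 1 := by
    simp only [v, CompactlySupportedContinuousMap.smul_apply]
    rw [integral_smul]
    exact inv_mul_cancel₀ hpos.ne'
  have hvi : Integrable v μ := v.continuous.integrable_of_hasCompactSupport v.hasCompactSupport
  let e : Lp ℝ 1 μ := hvi.toL1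
  have he : ∫ x, e x ∂μ = 1 := by rw [integral_congr_ae hvi.coeFn_toL1, hv]
  have hsmall : ∀ᶠ t in 𝓝 (1 : M), (∫ s, ‖rightTranslateCc t v s - v s‖ ∂μ) * ‖e‖ < ε / 2 := by
    have h := (tendsto_rightTranslateCc μ v).mul_const ‖e‖
    rw [zero_mul] at h
    exact h.eventually_lt_const (half_pos hε)
  obtain ⟨T, -, hT⟩ := hK.elim_nhds_subcover
    (fun t₀ => {t | (∫ s, ‖rightTranslateCc (t₀⁻¹ * t) v s - v s‖ ∂μ) * ‖e‖ < ε / 2})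
    (fun t₀ _ => by
      have h : Tendsto (fun t => t₀⁻¹ * t) (𝓝 t₀) (𝓝 1) := by
        have : Continuous fun t => t₀⁻¹ * t := by fun_prop
        simpa using this.tendsto t₀
      exact h.eventually hsmall)
  obtain ⟨f, hf, hfT⟩ := exists_finset_reiter μ hM e v T (half_pos hε)
  -- Having integral 1, and the bound on the translation defect below, are both convex conditions on
  -- f, so they need only be checked on the smears themselves.
  have hint : ∫ x, f x ∂μ = 1 := by
    have : convexHull ℝ (Set.range (smear μ e v)) ⊆ {f | L1.integralCLM f = 1} := by
      refine convexHull_min ?_ ((convex_singleton (1 : ℝ)).linear_preimage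
        (L1.integralCLM (μ := μ) (E := ℝ)).toLinearMap)
      rintro _ ⟨y, rfl⟩
      rw [Set.mem_ofPred_eq, ← L1.integral_eq, L1.integral_eq_integral, integral_smear, hv, he,
        one_mul]
    have := this hf
    rwa [Set.mem_ofPred_eq, ← L1.integral_eq, L1.integral_eq_integral] at this
  have hequi : ∀ t, ‖shift μ t f - f‖ ≤ (∫ s, ‖rightTranslateCc t v s - v s‖ ∂μ) * ‖e‖ := by
    intro t
    have : convexHull ℝ (Set.range (smear μ e v)) ⊆
        (shift μ t - ContinuousLinearMap.id ℝ (Lp ℝ 1 μ)).toLinearMap ⁻¹'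
          Metric.closedBall 0 ((∫ s, ‖rightTranslateCc t v s - v s‖ ∂μ) * ‖e‖) := by
      refine convexHull_min ?_ ((convex_closedBall _ _).linear_preimage _)
      rintro _ ⟨y, rfl⟩
      rw [Set.mem_preimage, mem_closedBall_zero_iff]
      change ‖shift μ t (smear μ e v y) - smear μ e v y‖ ≤ _
      rw [shift_smear, ← smear_sub]
      exact norm_smear_le μ e _ y
    exact mem_closedBall_zero_iff.1 (this hf)
  refine ⟨f, ?_, fun t ht => ?_⟩
  · rw [← hint, ← L1.integral_eq_integral]
    exact (le_abs_self _).trans (L1.norm_integral_le f)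
  · obtain ⟨t₀, ht₀, htt⟩ := Set.mem_iUnion₂.1 (hT ht)
    -- The first term is small by the uniform modulus of continuity, the second because t₀ belongs
    -- to the finite set.
    have h1 : shift μ t f - f = shift μ t₀ (shift μ (t₀⁻¹ * t) f - f) + (shift μ t₀ f - f) := by
      rw [map_sub, ← shift_mul, mul_inv_cancel_left]
      abel
    rw [h1]
    refine (norm_add_le _ _).trans_lt ?_
    rw [norm_shift]
    have h2 := (hequi (t₀⁻¹ * t)).trans_lt htt
    linarith [hfT t₀ ht₀]

end Reiter

end PInduced

namespace PInduced

open Measure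
open scoped Pointwise

theorem inv_four_add_inv_four : (4 : ℝ≥0∞)⁻¹ + 4⁻¹ = 2⁻¹ := by
  have h : (4 : ℝ≥0∞) = 2 * 2 := by norm_num
  rw [h, ENNReal.mul_inv (by simp) (by simp), ← mul_add, ENNReal.inv_two_add_inv_two, mul_one]

theorem le_two_mul_of_le_add_half {a b : ℝ≥0∞} (ha : a ≠ ⊤) (h : a ≤ b + 2⁻¹ * a) :
    a ≤ 2 * b := by
  have h1 : 2⁻¹ * a + 2⁻¹ * a ≤ b + 2⁻¹ * a := by
    rwa [← add_mul, ENNReal.inv_two_add_inv_two, one_mul]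
  have h2 := (ENNReal.add_le_add_iff_right (ENNReal.mul_ne_top (by simp) ha)).1 h1
  calc a = 2 * (2⁻¹ * a) := by
        rw [← mul_assoc, ENNReal.mul_inv_cancel (by simp) (by simp), one_mul]
    _ ≤ 2 * b := by gcongr

/-! ### Level sets for the layer-cake formula. -/

section LevelSets

/-- The positive reals below `u`. -/
def belowSet (u : ℝ≥0∞) : Set ℝ := {a | 0 < a ∧ ENNReal.ofReal a < u}

theorem belowSet_mono {u v : ℝ≥0∞} (h : u ≤ v) : belowSet u ⊆ belowSet v :=
  fun _ ha => ⟨ha.1, ha.2.trans_le h⟩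

theorem measurableSet_belowSet (u : ℝ≥0∞) : MeasurableSet (belowSet u) :=
  (measurableSet_lt measurable_const measurable_id).inter
    (measurableSet_lt ENNReal.measurable_ofReal measurable_const)

theorem volume_belowSet (u : ℝ≥0∞) : volume (belowSet u) = u := by
  induction u with
  | top =>
    have : belowSet ⊤ = Set.Ioi 0 := by ext a; simp [belowSet]
    rw [this, Real.volume_Ioi]
  | coe u =>
    have : belowSet u = Set.Ioo 0 (u : ℝ) := by
      ext a
      simp only [belowSet, Set.mem_ofPred_eq, Set.mem_Ioo, and_congr_right_iff]
      intro ha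
      rw [← ENNReal.ofReal_coe_nnreal, ENNReal.ofReal_lt_ofReal_iff_of_nonneg ha.le]
    rw [this, Real.volume_Ioo, sub_zero, ENNReal.ofReal_coe_nnreal]

/-- The sets are nested, which matches truncated subtraction; a value v = ⊤ is treated apart because
the measure of a difference requires finiteness. -/
theorem volume_belowSet_diff (u v : ℝ≥0∞) : volume (belowSet u \ belowSet v) = u - v := by
  rcases le_total u v with h | h
  · rw [Set.sdiff_eq_empty.2 (belowSet_mono h), measure_empty, tsub_eq_zero_of_le h]
  · by_cases hv : v = ⊤
    · subst hv
      rw [Set.sdiff_eq_empty.2 (belowSet_mono le_top), measure_empty, ENNReal.sub_top]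
    · rw [measure_sdiff (belowSet_mono h) (measurableSet_belowSet v).nullMeasurableSet
        (by rwa [volume_belowSet]), volume_belowSet, volume_belowSet]

end LevelSets

/-! ### Symmetric compact Følner sets. -/

section Folner

variable {M : Type*} [Group M] [TopologicalSpace M] [IsTopologicalGroup M]
  [LocallyCompactSpace M] [T2Space M] [SecondCountableTopology M]
  [MeasurableSpace M] [BorelSpace M] (μ : Measure M) [μ.IsHaarMeasure]

/-- Cutting |f₀| off in height and to a compact set makes the integral of f(x⁻¹) finite, which need
not hold for an L¹-function on a nonunimodular group. Monotone convergence makes the loss small. -/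
theorem exists_bounded_reiter (hM : IsAmenable M) {K : Set M} (hK : IsCompact K) {ε : ℝ≥0∞}
    (hε : ε ≠ 0) :
    ∃ f : M → ℝ≥0∞, Measurable f ∧ ∫⁻ x, f x ∂μ ≠ 0 ∧ ∫⁻ x, f x ∂μ ≠ ⊤ ∧
      ∫⁻ x, f x⁻¹ ∂μ ≠ ⊤ ∧ ∀ t ∈ K, ∫⁻ x, (f (t⁻¹ * x) - f x) ∂μ ≤ ε * ∫⁻ x, f x ∂μ := by
  -- Translation and truncation each cost at most ε/4. The bound 1/2 leaves mass at least 1/2 after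
  -- truncation, so the total error ε/2 is at most ε times that mass.
  obtain ⟨r, hr0, hr⟩ : ∃ r : ℝ≥0, 0 < r ∧ (r : ℝ≥0∞) < min (ε / 4) 2⁻¹ := by
    obtain ⟨r, hr0, hr⟩ := ENNReal.lt_iff_exists_nnreal_btwn.1
      (show 0 < min (ε / 4) 2⁻¹ from lt_min (ENNReal.div_pos hε (by simp)) (by simp))
    exact ⟨r, by exact_mod_cast hr0, hr⟩
  obtain ⟨f₀, hf₀, hK₀⟩ := exists_reiter μ hM hK (NNReal.coe_pos.2 hr0)
  have hm₀ : Measurable f₀ := (Lp.stronglyMeasurable f₀).measurable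
  have hint : ∫⁻ x, ‖f₀ x‖ₑ ∂μ = ENNReal.ofReal ‖f₀‖ := by
    exact (L1.ofReal_norm_eq_lintegral f₀).symm
  have hint1 : 1 ≤ ∫⁻ x, ‖f₀ x‖ₑ ∂μ := by rw [hint, ENNReal.one_le_ofReal]; exact hf₀
  let C := CompactExhaustion.choice M
  let F : ℕ → M → ℝ≥0∞ := fun n => (C n).indicator fun x => min ‖f₀ x‖ₑ n
  have hF : ∀ n, Measurable (F n) := fun n =>
    (hm₀.enorm.min measurable_const).indicator (C.isCompact n).measurableSet
  have hFle : ∀ n x, F n x ≤ ‖f₀ x‖ₑ := fun n x =>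
    (Set.indicator_le_self' (fun _ _ => zero_le) x).trans (min_le_left _ _)
  have hFmono : Monotone F := by
    intro m n hmn x
    refine Set.indicator_le_indicator_of_subset (C.subset hmn) (fun _ => zero_le) x |>.trans ?_
    refine Set.indicator_le_indicator (min_le_min_left _ ?_)
    exact_mod_cast hmn
  have hsup : ∀ x, ⨆ n, F n x = ‖f₀ x‖ₑ := by
    intro x
    refine le_antisymm (iSup_le fun n => hFle n x) ?_
    obtain ⟨k, hk⟩ := ENNReal.exists_nat_gt (enorm_ne_top (x := f₀ x))
    obtain ⟨n, hn⟩ := C.exists_mem x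
    refine le_iSup_of_le (max k n) ?_
    have hmem : x ∈ C (max k n) := C.subset (le_max_right k n) hn
    simp only [F, Set.indicator_of_mem hmem]
    refine le_min le_rfl (hk.le.trans ?_)
    exact_mod_cast le_max_left k n
  have hlim : ⨆ n, ∫⁻ x, F n x ∂μ = ∫⁻ x, ‖f₀ x‖ₑ ∂μ := by
    rw [← lintegral_iSup hF hFmono]
    simp_rw [hsup]
  have hfin : ∫⁻ x, ‖f₀ x‖ₑ ∂μ ≠ ⊤ := by rw [hint]; exact ENNReal.ofReal_ne_top
  obtain ⟨n, hn⟩ : ∃ n, ∫⁻ x, ‖f₀ x‖ₑ ∂μ - r < ∫⁻ x, F n x ∂μ := by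
    refine lt_iSup_iff.1 ?_
    rw [hlim]
    exact ENNReal.sub_lt_self hfin (one_pos.trans_le hint1).ne' (by exact_mod_cast hr0.ne')
  have hnfin : ∫⁻ x, F n x ∂μ ≠ ⊤ := ne_top_of_le_ne_top hfin (lintegral_mono (hFle n))
  have hrest : ∫⁻ x, (‖f₀ x‖ₑ - F n x) ∂μ ≤ r := by
    rw [lintegral_sub (hF n) hnfin (ae_of_all _ (hFle n))]
    exact tsub_le_iff_left.2 (tsub_le_iff_right.1 hn.le)
  have hhalf : 2⁻¹ ≤ ∫⁻ x, F n x ∂μ := by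
    refine le_trans ?_ hn.le
    have h1 : (2 : ℝ≥0∞)⁻¹ = 1 - 2⁻¹ := ENNReal.one_sub_inv_two.symm
    rw [h1]
    exact tsub_le_tsub hint1 (hr.le.trans (min_le_right _ _))
  refine ⟨F n, hF n, fun h => ?_, hnfin, ?_, fun t ht => ?_⟩
  · rw [h] at hhalf
    simp at hhalf
  · have hle : ∀ x, F n x⁻¹ ≤ (C n)⁻¹.indicator (fun _ => (n : ℝ≥0∞)) x := by
      intro x
      by_cases hx : x⁻¹ ∈ C n
      · rw [Set.indicator_of_mem (Set.mem_inv.2 hx)]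
        simp only [F, Set.indicator_of_mem hx]
        exact min_le_right _ _
      · simp only [F, Set.indicator_of_notMem hx]
        exact zero_le
    refine ne_top_of_le_ne_top ?_ (lintegral_mono hle)
    rw [lintegral_indicator_const (C.isCompact n).inv.measurableSet]
    exact ENNReal.mul_ne_top (ENNReal.natCast_ne_top n) (C.isCompact n).inv.measure_ne_top
  · have hshift : ∫⁻ x, ‖f₀ (t⁻¹ * x) - f₀ x‖ₑ ∂μ ≤ r := by
      have h1 := L1.ofReal_norm_sub_eq_lintegral (shift μ t f₀) f₀
      have h2 : ∫⁻ x, ‖f₀ (t⁻¹ * x) - f₀ x‖ₑ ∂μ = ∫⁻ x, ‖shift μ t f₀ x - f₀ x‖ₑ ∂μ := by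
        refine lintegral_congr_ae ?_
        filter_upwards [shift_ae_eq μ t f₀] with x hx
        rw [hx]
      rw [h2, ← h1]
      exact ENNReal.ofReal_le_of_le_toReal (by simpa using (hK₀ t ht).le)
    have hpt : ∀ x, F n (t⁻¹ * x) - F n x ≤
        ‖f₀ (t⁻¹ * x) - f₀ x‖ₑ + (‖f₀ x‖ₑ - F n x) := by
      intro x
      rw [tsub_le_iff_right, add_assoc, tsub_add_cancel_of_le (hFle n x)]
      refine (hFle n _).trans ?_
      have := enorm_add_le (f₀ (t⁻¹ * x) - f₀ x) (f₀ x)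
      rwa [sub_add_cancel] at this
    refine (lintegral_mono hpt).trans ?_
    rw [lintegral_add_right (g := fun x => ‖f₀ x‖ₑ - F n x) _ (hm₀.enorm.sub (hF n))]
    have hr4 : (r : ℝ≥0∞) ≤ ε / 4 := hr.le.trans (min_le_left _ _)
    calc _ ≤ ε / 4 + ε / 4 := add_le_add (hshift.trans hr4) (hrest.trans hr4)
      _ = ε * 2⁻¹ := by rw [div_eq_mul_inv, ← mul_add, inv_four_add_inv_four]
      _ ≤ _ := by gcongr

/-- An amenable group has almost invariant, inversion-invariant integrable functions. -/
theorem exists_symmetric_reiter (hM : IsAmenable M) {K : Set M} (hK : IsCompact K) {ε : ℝ≥0∞}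
    (hε : ε ≠ 0) :
    ∃ h : M → ℝ≥0∞, Measurable h ∧ (∀ x, h x⁻¹ = h x) ∧ ∫⁻ x, h x ∂μ ≠ 0 ∧ ∫⁻ x, h x ∂μ ≠ ⊤ ∧
      ∀ t ∈ K, ∫⁻ x, (h (t⁻¹ * x) - h x) ∂μ ≤ ε * ∫⁻ x, h x ∂μ := by
  obtain ⟨f, hf, hf0, hft, hfi, hfK⟩ := exists_bounded_reiter μ hM hK hε
  have hsub : ∀ t, Measurable fun s => f (t⁻¹ * s) - f s := fun t =>
    (hf.comp (measurable_const_mul _)).sub hf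
  have hconv : ∀ k : M → ℝ≥0∞, Measurable k →
      ∫⁻ x, ∫⁻ s, k s * f (x⁻¹ * s) ∂μ ∂μ = (∫⁻ s, k s ∂μ) * ∫⁻ x, f x⁻¹ ∂μ := by
    intro k hk
    rw [lintegral_lintegral_swap, ← lintegral_mul_const _ hk]
    · refine lintegral_congr fun s => ?_
      rw [lintegral_const_mul _ (show Measurable fun x => f (x⁻¹ * s) from
        hf.comp (measurable_inv.mul_const s)),
        ← lintegral_mul_left_eq_self (fun x => f (x⁻¹ * s)) s]
      simp
    · exact ((hk.comp measurable_snd).mul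
        (hf.comp (measurable_fst.inv.mul measurable_snd))).aemeasurable
  have hfi0 : ∫⁻ x, f x⁻¹ ∂μ ≠ 0 := by
    intro h
    apply hf0
    rw [lintegral_eq_zero_iff (show Measurable fun x => f x⁻¹ from hf.comp measurable_inv)] at h
    rw [lintegral_eq_zero_iff hf]
    have h2 := (quasiMeasurePreserving_inv μ).ae h
    filter_upwards [h2] with x hx
    simpa using hx
  have hm : Measurable fun x => ∫⁻ s, f s * f (x⁻¹ * s) ∂μ := by
    have : Measurable fun p : M × M => f p.2 * f (p.1⁻¹ * p.2) :=
      (hf.comp measurable_snd).mul (hf.comp (measurable_fst.inv.mul measurable_snd))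
    exact this.lintegral_prod_right'
  -- Substituting s ↦ x⁻¹s shows that this correlation is inversion invariant. Translating it by t
  -- translates only the first factor f, so the defect of f is multiplied by ∫ f(x⁻¹) dx, as is the
  -- total mass.
  refine ⟨fun x => ∫⁻ s, f s * f (x⁻¹ * s) ∂μ, hm, fun x => ?_, ?_, ?_, fun t ht => ?_⟩
  · change ∫⁻ s, f s * f (x⁻¹⁻¹ * s) ∂μ = ∫⁻ s, f s * f (x⁻¹ * s) ∂μ
    rw [← lintegral_mul_left_eq_self (fun s => f s * f (x⁻¹⁻¹ * s)) x⁻¹]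
    refine lintegral_congr fun s => ?_
    rw [inv_inv, mul_inv_cancel_left, mul_comm]
  · rw [hconv f hf]
    exact mul_ne_zero hf0 hfi0
  · rw [hconv f hf]
    exact ENNReal.mul_ne_top hft hfi
  · rw [hconv f hf, ← mul_assoc]
    refine le_trans ?_ (mul_le_mul_left (hfK t ht) _)
    rw [← hconv _ (hsub t)]
    refine lintegral_mono fun x => ?_
    simp only
    rw [tsub_le_iff_right, ← lintegral_mul_left_eq_self (fun s => f s * f ((t⁻¹ * x)⁻¹ * s)) t⁻¹,
      ← lintegral_add_left]
    · refine lintegral_mono fun s => ?_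
      simp only
      rw [← add_mul]
      have e : (t⁻¹ * x)⁻¹ * (t⁻¹ * s) = x⁻¹ * s := by group
      rw [e]
      gcongr
      exact le_tsub_add
    · exact (hsub t).mul (hf.comp (measurable_const_mul _))

theorem measurable_measure_translate {A : Set M} (hA : MeasurableSet A) :
    Measurable fun t => μ ((fun x => t⁻¹ * x) ⁻¹' A \ A) := by
  have : MeasurableSet {p : M × M | p.1⁻¹ * p.2 ∈ A ∧ p.2 ∉ A} :=
    (hA.preimage (measurable_fst.inv.mul measurable_snd)).inter (hA.compl.preimage measurable_snd)
  exact measurable_measure_prodMk_left this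

/-- The set is a superlevel set of a symmetric almost invariant h. If every level failed,
integrating over levels and exchanging integrals would contradict the almost invariance of h. The
strict inequality also forces A to have positive measure. -/
theorem exists_symmetric_almost_invariant_average (hM : IsAmenable M) {K : Set M}
    (hK : IsCompact K) {ε : ℝ≥0∞} (hε : ε ≠ 0) :
    ∃ A : Set M, MeasurableSet A ∧ A⁻¹ = A ∧ μ A ≠ ⊤ ∧
      ∫⁻ t in K, μ ((fun x => t⁻¹ * x) ⁻¹' A \ A) ∂μ < ε * μ A := by
  obtain ⟨r, hr0, hr⟩ := ENNReal.exists_nnreal_pos_mul_lt (hK.measure_ne_top (μ := μ)) hε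
  obtain ⟨h, hm, hsymm, h0, htop, hh⟩ := exists_symmetric_reiter μ hM hK
    (ε := r) (by exact_mod_cast hr0.ne')
  let A : ℝ → Set M := fun a => {x | a ∈ belowSet (h x)}
  have hPm : MeasurableSet {p : ℝ × M | p.1 ∈ belowSet (h p.2)} :=
    (measurableSet_lt measurable_const measurable_fst).inter
      (measurableSet_lt (ENNReal.measurable_ofReal.comp measurable_fst) (hm.comp measurable_snd))
  have hAm : ∀ a, MeasurableSet (A a) := fun a => measurable_prodMk_left hPm
  have hAsymm : ∀ a, (A a)⁻¹ = A a := fun a => by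
    ext x
    simp [A, hsymm]
  have hvol : ∫⁻ a, μ (A a) = ∫⁻ x, h x ∂μ := by
    have h1 := prod_apply (μ := volume) (ν := μ) hPm
    rw [prod_apply_symm hPm] at h1
    calc _ = ∫⁻ x, volume (belowSet (h x)) ∂μ := h1.symm
      _ = _ := by simp_rw [volume_belowSet]
  have hdiff : ∀ t, ∫⁻ a, μ ((fun x => t⁻¹ * x) ⁻¹' A a \ A a) =
      ∫⁻ x, (h (t⁻¹ * x) - h x) ∂μ := by
    intro t
    have hP : MeasurableSet
        {p : ℝ × M | p.1 ∈ belowSet (h (t⁻¹ * p.2)) ∧ p.1 ∉ belowSet (h p.2)} := by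
      refine MeasurableSet.inter ?_ hPm.compl
      exact hPm.preimage (measurable_fst.prodMk (measurable_const.mul measurable_snd))
    have h1 := prod_apply (μ := volume) (ν := μ) hP
    rw [prod_apply_symm hP] at h1
    calc _ = ∫⁻ x, volume (belowSet (h (t⁻¹ * x)) \ belowSet (h x)) ∂μ := h1.symm
      _ = _ := by simp_rw [volume_belowSet_diff]
  by_contra! hcon
  have hfin : ∀ a, 0 < a → μ (A a) ≠ ⊤ := by
    intro a ha
    have h1 : ENNReal.ofReal a * μ (A a) ≤ ∫⁻ x, h x ∂μ := by
      refine le_trans ?_ (mul_meas_ge_le_lintegral hm (ENNReal.ofReal a))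
      gcongr
      exact fun x hx => hx.2.le
    intro htop'
    rw [htop', ENNReal.mul_top (by simpa using ha)] at h1
    exact htop (top_le_iff.1 h1)
  have hle : ∀ a, ε * μ (A a) ≤ ∫⁻ t in K, μ ((fun x => t⁻¹ * x) ⁻¹' A a \ A a) ∂μ := by
    intro a
    by_cases ha : 0 < a
    · exact hcon (A a) (hAm a) (hAsymm a) (hfin a ha)
    · have : A a = ∅ := by
        ext x
        simp [A, belowSet, ha]
      simp [this]
  have hmeas : Measurable fun p : ℝ × M => μ ((fun x => p.2⁻¹ * x) ⁻¹' A p.1 \ A p.1) := by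
    have : MeasurableSet {q : (ℝ × M) × M | q.1.1 ∈ belowSet (h (q.1.2⁻¹ * q.2)) ∧
        q.1.1 ∉ belowSet (h q.2)} := by
      refine MeasurableSet.inter ?_ (MeasurableSet.compl ?_)
      · exact hPm.preimage (measurable_fst.fst.prodMk (measurable_fst.snd.inv.mul measurable_snd))
      · exact hPm.preimage (measurable_fst.fst.prodMk measurable_snd)
    exact measurable_measure_prodMk_left this
  have hmA : Measurable fun a => μ (A a) := measurable_measure_prodMk_left hPm
  have hfinal : ε * ∫⁻ x, h x ∂μ ≤ r * μ K * ∫⁻ x, h x ∂μ := by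
    calc ε * ∫⁻ x, h x ∂μ = ∫⁻ a, ε * μ (A a) := by
          rw [← hvol, lintegral_const_mul _ hmA]
      _ ≤ ∫⁻ a, ∫⁻ t in K, μ ((fun x => t⁻¹ * x) ⁻¹' A a \ A a) ∂μ := lintegral_mono hle
      _ = ∫⁻ t in K, (∫⁻ a : ℝ, μ ((fun x => t⁻¹ * x) ⁻¹' A a \ A a)) ∂μ :=
          lintegral_lintegral_swap hmeas.aemeasurable
      _ ≤ ∫⁻ _ in K, r * ∫⁻ x, h x ∂μ ∂μ := by
          refine setLIntegral_mono' hK.measurableSet fun t ht => ?_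
          rw [hdiff]
          exact hh t ht
      _ = r * μ K * ∫⁻ x, h x ∂μ := by
          rw [setLIntegral_const]
          ring
  exact absurd ((ENNReal.mul_le_mul_iff_left h0 htop).1 hfinal) (not_le.2 hr)

/-- Averaging over B ∪ KB leaves an exceptional set N of measure below |B|/2. For t ∈ K, the sets N
and t⁻¹N cannot cover B, so some b ∈ B has both b and tb good. Writing t = (tb)b⁻¹ bounds the defect
at t by the sum of those at b and tb. -/
theorem exists_symmetric_almost_invariant (hM : IsAmenable M) {K : Set M} (hK : IsCompact K)
    {δ : ℝ≥0∞} (hδ : δ ≠ 0) (hδt : δ ≠ ⊤) :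
    ∃ A : Set M, MeasurableSet A ∧ A⁻¹ = A ∧ μ A ≠ 0 ∧ μ A ≠ ⊤ ∧
      ∀ t ∈ K, μ ((fun x => t⁻¹ * x) ⁻¹' A \ A) ≤ δ * μ A := by
  obtain ⟨B⟩ : Nonempty (TopologicalSpace.PositiveCompacts M) := inferInstance
  have hB0 : μ B ≠ 0 := (measure_pos_of_nonempty_interior μ B.interior_nonempty).ne'
  have hBt : μ B ≠ ⊤ := B.isCompact.measure_ne_top
  have hδ2 : δ / 2 ≠ 0 := (ENNReal.div_pos hδ (by simp)).ne'
  have hδ2t : δ / 2 ≠ ⊤ := ENNReal.div_ne_top hδt (by simp)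
  have hB2 : μ B / 2 ≠ 0 := (ENNReal.div_pos hB0 (by simp)).ne'
  obtain ⟨A, hA, hsymm, hAt, hav⟩ := exists_symmetric_almost_invariant_average μ hM
    (B.isCompact.union (hK.mul B.isCompact)) (mul_ne_zero hδ2 hB2)
  have hA0 : μ A ≠ 0 := by
    intro h
    rw [h, mul_zero] at hav
    exact not_lt_zero hav
  refine ⟨A, hA, hsymm, hA0, hAt, fun t ht => ?_⟩
  let φ : M → ℝ≥0∞ := fun t => μ ((fun x => t⁻¹ * x) ⁻¹' A \ A)
  have hφ : Measurable φ := measurable_measure_translate μ hA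
  let N : Set M := ((B : Set M) ∪ K * B) ∩ {t | δ / 2 * μ A < φ t}
  have hN : μ N < μ B / 2 := by
    have h1 : δ / 2 * μ A * μ N ≤ ∫⁻ t in (B : Set M) ∪ K * B, φ t ∂μ := by
      refine le_trans ?_ (mul_meas_ge_le_lintegral hφ (δ / 2 * μ A))
      rw [restrict_apply (measurableSet_le measurable_const hφ)]
      gcongr
      exact fun x hx => ⟨show δ / 2 * μ A ≤ φ x from le_of_lt hx.2, hx.1⟩
    have h2 := h1.trans_lt hav
    have e : δ / 2 * (μ B / 2) * μ A = δ / 2 * μ A * (μ B / 2) := by ring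
    rw [e] at h2
    exact lt_of_mul_lt_mul_left' h2
  obtain ⟨b, hb, hbN, htbN⟩ : ∃ b ∈ (B : Set M), b ∉ N ∧ t * b ∉ N := by
    by_contra! hcon
    have hsub : (B : Set M) ⊆ N ∪ (fun b => t * b) ⁻¹' N := fun b hb => by
      by_cases h : b ∈ N
      · exact Or.inl h
      · exact Or.inr (hcon b hb h)
    have := (measure_mono hsub).trans (measure_union_le _ _) |>.trans_lt
      (ENNReal.add_lt_add hN (by rwa [measure_preimage_mul]))
    rw [ENNReal.add_halves] at this
    exact lt_irrefl _ this
  have h1 : φ b ≤ δ / 2 * μ A := by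
    by_contra! h
    exact hbN ⟨Or.inl hb, h⟩
  have h2 : φ (t * b) ≤ δ / 2 * μ A := by
    by_contra! h
    exact htbN ⟨Or.inr (Set.mul_mem_mul ht hb), h⟩
  have hAb : ∀ c : M, MeasurableSet ((fun x => c * x) ⁻¹' A) := fun c =>
    hA.preimage (measurable_const_mul c)
  -- A and bA have the same finite measure, so A \ bA and bA \ A do too.
  have h3 : μ ((fun x => b * x) ⁻¹' A \ A) = φ b := by
    have e1 : φ b = μ (A \ (fun x => b * x) ⁻¹' A) := by
      rw [← measure_preimage_mul μ b⁻¹ (A \ _)]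
      refine congrArg μ (Set.ext fun x => ?_)
      simp
    rw [e1, ← ENNReal.add_right_inj (a := μ (A ∩ (fun x => b * x) ⁻¹' A))
      (ne_top_of_le_ne_top hAt (measure_mono Set.inter_subset_left)),
      measure_inter_add_sdiff _ (hAb b), Set.inter_comm, measure_inter_add_sdiff _ hA,
      measure_preimage_mul]
  have hsub : (fun x => t⁻¹ * x) ⁻¹' A \ A ⊆
      (fun x => t⁻¹ * x) ⁻¹' (A \ (fun x => b⁻¹ * x) ⁻¹' A) ∪
        ((fun x => (t * b)⁻¹ * x) ⁻¹' A \ A) := by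
    rintro x ⟨hx1, hx2⟩
    by_cases h : b⁻¹ * (t⁻¹ * x) ∈ A
    · right
      refine ⟨?_, hx2⟩
      simpa [mul_assoc] using h
    · exact Or.inl ⟨hx1, h⟩
  have h4 : μ (A \ (fun x => b⁻¹ * x) ⁻¹' A) = φ b := by
    rw [← h3, ← measure_preimage_mul μ b (A \ _)]
    refine congrArg μ (Set.ext fun x => ?_)
    simp
  calc μ ((fun x => t⁻¹ * x) ⁻¹' A \ A) ≤ φ b + φ (t * b) := by
        refine (measure_mono hsub).trans ((measure_union_le _ _).trans_eq ?_)
        rw [measure_preimage_mul, h4]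
    _ ≤ δ / 2 * μ A + δ / 2 * μ A := add_le_add h1 h2
    _ = δ * μ A := by rw [← add_mul, ENNReal.add_halves]

theorem exists_compact_symmetric_almost_invariant (hM : IsAmenable M) {K : Set M}
    (hK : IsCompact K) {δ : ℝ≥0∞} (hδ : δ ≠ 0) :
    ∃ A : Set M, IsCompact A ∧ A⁻¹ = A ∧ μ A ≠ 0 ∧
      ∀ t ∈ K, μ ((fun x => t⁻¹ * x) ⁻¹' A \ A) ≤ δ * μ A := by
  -- Two errors of size d|A| occur, and |A| is at most twice the measure of the compact set; the
  -- bound 1/2 on d ensures the latter.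
  let d : ℝ≥0∞ := min (δ / 4) 2⁻¹
  have hd0 : d ≠ 0 := (lt_min (ENNReal.div_pos hδ (by simp)) (by simp)).ne'
  have hdt : d ≠ ⊤ := ne_top_of_le_ne_top (by simp) (min_le_right _ _)
  obtain ⟨A, hA, hsymm, hA0, hAt, hAK⟩ := exists_symmetric_almost_invariant μ hM hK hd0 hdt
  obtain ⟨C, hCA, hC, hCd⟩ := hA.exists_isCompact_sdiff_lt hAt (mul_ne_zero hd0 hA0)
  have hC'A : C ∪ C⁻¹ ⊆ A := by
    refine Set.union_subset hCA ?_
    rw [← hsymm]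
    exact Set.inv_subset_inv.2 hCA
  have hdiff : μ (A \ (C ∪ C⁻¹)) ≤ d * μ A :=
    (measure_mono (Set.sdiff_subset_sdiff_right Set.subset_union_left)).trans hCd.le
  have hAC : μ A ≤ 2 * μ (C ∪ C⁻¹) := by
    have h1 : μ A ≤ μ (C ∪ C⁻¹) + 2⁻¹ * μ A := by
      calc μ A ≤ μ ((C ∪ C⁻¹) ∪ (A \ (C ∪ C⁻¹))) := measure_mono (by simp)
        _ ≤ μ (C ∪ C⁻¹) + μ (A \ (C ∪ C⁻¹)) := measure_union_le _ _
        _ ≤ _ := by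
          gcongr
          refine hdiff.trans ?_
          gcongr
          exact min_le_right _ _
    exact le_two_mul_of_le_add_half hAt h1
  refine ⟨C ∪ C⁻¹, hC.union hC.inv, ?_, ?_, fun t ht => ?_⟩
  · rw [Set.union_inv, inv_inv, Set.union_comm]
  · intro h
    rw [h, mul_zero] at hAC
    exact hA0 (le_zero_iff.1 hAC)
  · calc μ ((fun x => t⁻¹ * x) ⁻¹' (C ∪ C⁻¹) \ (C ∪ C⁻¹))
        ≤ μ (((fun x => t⁻¹ * x) ⁻¹' A \ A) ∪ (A \ (C ∪ C⁻¹))) := by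
          refine measure_mono ?_
          rintro x ⟨hx1, hx2⟩
          by_cases hx : x ∈ A
          · exact Or.inr ⟨hx, hx2⟩
          · exact Or.inl ⟨hC'A hx1, hx⟩
      _ ≤ d * μ A + d * μ A := (measure_union_le _ _).trans (add_le_add (hAK t ht) hdiff)
      _ ≤ δ / 4 * (2 * μ (C ∪ C⁻¹)) + δ / 4 * (2 * μ (C ∪ C⁻¹)) := by
          gcongr <;> exact min_le_left _ _
      _ = δ * (4⁻¹ + 4⁻¹) * 2 * μ (C ∪ C⁻¹) := by
        rw [div_eq_mul_inv]
        ring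
      _ = δ * μ (C ∪ C⁻¹) := by
        rw [inv_four_add_inv_four, mul_assoc δ, ENNReal.inv_mul_cancel (by simp) (by simp),
          mul_one]

/-- By Fubini, each x ∈ A contributes the measure of the set of t with t⁻¹x ∈ A. Symmetry turns this
set into xA rather than xA⁻¹, so no modular factor appears. -/
theorem lintegral_measure_inter_translate {A : Set M} (hA : MeasurableSet A) (hsymm : A⁻¹ = A) :
    ∫⁻ t, μ ((fun x => t⁻¹ * x) ⁻¹' A ∩ A) ∂μ = μ A * μ A := by
  have hP : MeasurableSet {p : M × M | p.1⁻¹ * p.2 ∈ A ∧ p.2 ∈ A} :=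
    (hA.preimage (measurable_fst.inv.mul measurable_snd)).inter (hA.preimage measurable_snd)
  have h1 := prod_apply (μ := μ) (ν := μ) hP
  rw [prod_apply_symm hP] at h1
  refine h1.symm.trans ?_
  rw [← lintegral_indicator_const hA]
  refine lintegral_congr fun x => ?_
  by_cases hx : x ∈ A
  · rw [Set.indicator_of_mem hx]
    have : (fun t : M => (t, x)) ⁻¹' {p : M × M | p.1⁻¹ * p.2 ∈ A ∧ p.2 ∈ A} =
        (fun t => x⁻¹ * t) ⁻¹' A := by
      ext t
      have : t⁻¹ * x ∈ A ↔ x⁻¹ * t ∈ A := by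
        conv_lhs => rw [← hsymm]
        simp
      simp [hx, this]
    rw [this, measure_preimage_mul]
  · simp [hx]

/-- Haar measure is infinite, so there is a compact L with |L| > 2R. If A loses at most half its
measure under each t ∈ L, then integrating |tA ∩ A| ≥ |A|/2 over L gives |A| |L| / 2 ≤ |A|². -/
theorem exists_large_compact_symmetric_almost_invariant [NoncompactSpace M] (hM : IsAmenable M)
    {K : Set M} (hK : IsCompact K) {δ R : ℝ≥0∞} (hδ : δ ≠ 0) (hR : R ≠ ⊤) :
    ∃ A : Set M, IsCompact A ∧ A⁻¹ = A ∧ R ≤ μ A ∧ μ A ≠ 0 ∧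
      ∀ t ∈ K, μ ((fun x => t⁻¹ * x) ⁻¹' A \ A) ≤ δ * μ A := by
  obtain ⟨L, hL, hRL⟩ : ∃ L : Set M, IsCompact L ∧ 2 * R < μ L := by
    have h1 : 2 * R < μ Set.univ := by
      rw [measure_univ_of_isMulLeftInvariant]
      exact (ENNReal.mul_ne_top (by simp) hR).lt_top
    obtain ⟨L, -, hL, h⟩ := MeasurableSet.univ.exists_lt_isCompact h1
    exact ⟨L, hL, h⟩
  obtain ⟨A, hA, hsymm, hA0, hAK⟩ := exists_compact_symmetric_almost_invariant μ hM
    (hK.union hL) (δ := min δ 2⁻¹) (lt_min hδ.bot_lt (by simp)).ne'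
  have hAt : μ A ≠ ⊤ := hA.measure_ne_top
  refine ⟨A, hA, hsymm, ?_, hA0, fun t ht => (hAK t (Or.inl ht)).trans ?_⟩
  · have h1 : ∀ t ∈ L, μ A * 2⁻¹ ≤ μ ((fun x => t⁻¹ * x) ⁻¹' A ∩ A) := by
      intro t ht
      have h2 := measure_inter_add_sdiff (μ := μ) ((fun x => t⁻¹ * x) ⁻¹' A) hA.measurableSet
      rw [measure_preimage_mul] at h2
      have h3 : μ ((fun x => t⁻¹ * x) ⁻¹' A \ A) ≤ 2⁻¹ * μ A :=
        (hAK t (Or.inr ht)).trans (mul_le_mul_left (min_le_right _ _) _)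
      have h4 := le_two_mul_of_le_add_half hAt (h2.symm.le.trans (add_le_add_right h3 _))
      rw [← div_eq_mul_inv]
      exact ENNReal.div_le_of_le_mul' h4
    have h2 : μ A * 2⁻¹ * μ L ≤ μ A * μ A := by
      rw [← lintegral_measure_inter_translate μ hA.measurableSet hsymm, ← setLIntegral_const]
      exact (setLIntegral_mono' hL.measurableSet h1).trans (setLIntegral_le_lintegral _ _)
    rw [mul_assoc, ENNReal.mul_le_mul_iff_right hA0 hAt] at h2
    refine le_trans ?_ h2
    rw [mul_comm, ← div_eq_mul_inv, ENNReal.le_div_iff_mul_le (by simp) (by simp), mul_comm]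
    exact hRL.le
  · gcongr
    exact min_le_left _ _

/-- Symmetric compact almost invariant sets containing a prescribed compact set. -/
theorem exists_folner_superset (hM : IsAmenable M) {K D : Set M} (hK : IsCompact K)
    (hD : IsCompact D) (hDsymm : D⁻¹ = D) {δ : ℝ≥0∞} (hδ : δ ≠ 0) :
    ∃ A : Set M, IsCompact A ∧ A⁻¹ = A ∧ D ⊆ A ∧ μ A ≠ 0 ∧
      ∀ t ∈ K, μ ((fun x => t⁻¹ * x) ⁻¹' A \ A) ≤ δ * μ A := by
  by_cases hc : CompactSpace M
  · refine ⟨Set.univ, isCompact_univ, Set.inv_univ, Set.subset_univ D, ?_, fun t _ => by simp⟩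
    exact (Measure.measure_univ_pos.2 (NeZero.ne μ)).ne'
  rw [not_compactSpace_iff] at hc
  have hδ2 : δ / 2 ≠ 0 := (ENNReal.div_pos hδ (by simp)).ne'
  -- The size threshold makes |D| at most (δ/2)|A|, so translating D costs no more than translating
  -- A.
  obtain ⟨A, hA, hsymm, hR, hA0, hAK⟩ := exists_large_compact_symmetric_almost_invariant μ hM hK
    (δ := δ / 2) (R := μ D / (δ / 2)) hδ2 (ENNReal.div_ne_top hD.measure_ne_top hδ2)
  refine ⟨A ∪ D, hA.union hD, by rw [Set.union_inv, hsymm, hDsymm], Set.subset_union_right, ?_,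
    fun t ht => ?_⟩
  · exact fun h => hA0 (measure_mono_null Set.subset_union_left h)
  · have hDA : μ D ≤ δ / 2 * μ A := by
      rwa [ENNReal.div_le_iff_le_mul (Or.inl hδ2) (Or.inr hA0), mul_comm] at hR
    calc μ ((fun x => t⁻¹ * x) ⁻¹' (A ∪ D) \ (A ∪ D))
        ≤ μ (((fun x => t⁻¹ * x) ⁻¹' A \ A) ∪ (fun x => t⁻¹ * x) ⁻¹' D) := by
          refine measure_mono ?_
          rintro x ⟨hx1 | hx1, hx2⟩
          · exact Or.inl ⟨hx1, fun h => hx2 (Or.inl h)⟩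
          · exact Or.inr hx1
      _ ≤ δ / 2 * μ A + δ / 2 * μ A := by
          refine (measure_union_le _ _).trans (add_le_add (hAK t ht) ?_)
          rwa [measure_preimage_mul]
      _ = δ * μ A := by rw [← add_mul, ENNReal.add_halves]
      _ ≤ δ * μ (A ∪ D) := by
          gcongr
          exact Set.subset_union_left

end Folner

end PInduced

namespace PInduced

/-! ### From Følner sets to exhaustions. -/

section Exhaustion

variable {M : Type*} [Group M] [TopologicalSpace M] [IsTopologicalGroup M]
  [LocallyCompactSpace M] [T2Space M] [SecondCountableTopology M]
  [MeasurableSpace M] [BorelSpace M] (μ : Measure M) [μ.IsHaarMeasure]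

theorem rpow_mul_rpow_of_holderConjugate {p q : ℝ≥0∞} (hpq : p.HolderConjugate q) {a : ℝ}
    (ha : 0 < a) : a ^ (-(p⁻¹).toReal) * a ^ (-(q⁻¹).toReal) = a⁻¹ := by
  have h : p⁻¹ + q⁻¹ = 1 := ENNReal.HolderConjugate.inv_add_inv_eq_one p q
  have hp : p⁻¹ ≠ ⊤ := ne_top_of_le_ne_top ENNReal.one_ne_top (h ▸ le_self_add)
  have hq : q⁻¹ ≠ ⊤ := ne_top_of_le_ne_top ENNReal.one_ne_top (h ▸ le_add_self)
  have h' : (p⁻¹).toReal + (q⁻¹).toReal = 1 := by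
    rw [← ENNReal.toReal_add hp hq, h, ENNReal.toReal_one]
  rw [← Real.rpow_add ha, ← neg_add, h', Real.rpow_neg_one]

/-- Symmetry turns s⁻¹t ∈ A into s ∈ tA, and the two normalizations multiply to 1/|A|. The exponents
disappear, so one sequence serves all conjugate pairs. -/
theorem conv_normInd {A : Set M} (hA : IsCompact A) (hsymm : (fun s => s⁻¹) ⁻¹' A = A)
    (hA0 : 0 < μ A) {p q : ℝ≥0∞} (hpq : p.HolderConjugate q) (t : M) :
    conv μ (normInd μ p A) (normInd μ q A) t =
      ((μ.real ((fun x => t⁻¹ * x) ⁻¹' A ∩ A) / μ.real A : ℝ) : ℂ) := by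
  have hAr : 0 < μ.real A := ENNReal.toReal_pos hA0.ne' hA.measure_ne_top
  have h1 : ∀ s, normInd μ p A s * normInd μ q A (s⁻¹ * t) =
      ((fun x => t⁻¹ * x) ⁻¹' A ∩ A).indicator (fun _ => (((μ.real A)⁻¹ : ℝ) : ℂ)) s := by
    intro s
    have hs : s⁻¹ * t ∈ A ↔ t⁻¹ * s ∈ A := by
      conv_lhs => rw [← hsymm]
      simp
    by_cases h2 : s ∈ A <;> by_cases h3 : t⁻¹ * s ∈ A <;>
      simp only [normInd, Set.indicator, Set.mem_inter_iff, Set.mem_preimage, hs, h2, h3, if_true,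
        if_false, and_self, and_true, and_false, zero_mul, mul_zero]
    rw [← Complex.ofReal_mul, rpow_mul_rpow_of_holderConjugate hpq hAr]
  have hm : MeasurableSet ((fun x => t⁻¹ * x) ⁻¹' A ∩ A) :=
    (hA.measurableSet.preimage (measurable_const_mul _)).inter hA.measurableSet
  rw [conv]
  simp_rw [h1]
  rw [integral_indicator_const _ hm, Complex.real_smul, ← Complex.ofReal_mul, div_eq_mul_inv]

theorem norm_conv_normInd_sub_one_le {A : Set M} (hA : IsCompact A)
    (hsymm : (fun s => s⁻¹) ⁻¹' A = A) (hA0 : 0 < μ A) {p q : ℝ≥0∞} (hpq : p.HolderConjugate q)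
    {t : M} {δ : ℝ} (hδ : 0 ≤ δ)
    (h : μ ((fun x => t⁻¹ * x) ⁻¹' A \ A) ≤ ENNReal.ofReal δ * μ A) :
    ‖conv μ (normInd μ p A) (normInd μ q A) t - 1‖ ≤ δ := by
  have hAr : 0 < μ.real A := ENNReal.toReal_pos hA0.ne' hA.measure_ne_top
  have htA : IsCompact ((fun x => t⁻¹ * x) ⁻¹' A) := (Homeomorph.mulLeft t⁻¹).isCompact_preimage.2 hA
  have h1 : μ.real ((fun x => t⁻¹ * x) ⁻¹' A ∩ A) + μ.real ((fun x => t⁻¹ * x) ⁻¹' A \ A) =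
      μ.real A := by
    rw [measureReal_inter_add_sdiff hA.measurableSet htA.measure_ne_top, measureReal_def,
      measure_preimage_mul, measureReal_def]
  have h2 : μ.real ((fun x => t⁻¹ * x) ⁻¹' A \ A) ≤ δ * μ.real A := by
    have := ENNReal.toReal_mono (ENNReal.mul_ne_top ENNReal.ofReal_ne_top hA.measure_ne_top) h
    rwa [ENNReal.toReal_mul, ENNReal.toReal_ofReal hδ] at this
  have h3 : μ.real ((fun x => t⁻¹ * x) ⁻¹' A ∩ A) / μ.real A - 1 =
      -(μ.real ((fun x => t⁻¹ * x) ⁻¹' A \ A) / μ.real A) := by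
    rw [div_sub_one hAr.ne', ← neg_div]
    congr 1
    linarith
  rw [conv_normInd μ hA hsymm hA0 hpq, ← Complex.ofReal_one, ← Complex.ofReal_sub,
    Complex.norm_real, h3, norm_neg, Real.norm_of_nonneg (by positivity), div_le_iff₀ hAr]
  exact h2

/-- An amenable group has an exhaustion by symmetric almost invariant compact sets. -/
theorem exists_isExhaustion (hM : IsAmenable M) : ∃ A : ℕ → Set M, IsExhaustion μ A := by
  let C := CompactExhaustion.choice M
  have step : ∀ (n : ℕ) (D : {D : Set M // IsCompact D ∧ D⁻¹ = D}),
      ∃ A : {D : Set M // IsCompact D ∧ D⁻¹ = D}, D.1 ⊆ A.1 ∧ C n ⊆ A.1 ∧ μ A.1 ≠ 0 ∧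
        ∀ t ∈ C n, μ ((fun x => t⁻¹ * x) ⁻¹' A.1 \ A.1) ≤
          ENNReal.ofReal (1 / ((n : ℝ) + 1)) * μ A.1 := by
    intro n D
    obtain ⟨A, hA, hAs, hsub, hA0, h⟩ := exists_folner_superset μ hM (K := C n)
      (D := D.1 ∪ (C n ∪ (C n)⁻¹)) (C.isCompact n)
      (D.2.1.union ((C.isCompact n).union (C.isCompact n).inv))
      (by rw [Set.union_inv, Set.union_inv, inv_inv, D.2.2, Set.union_comm (C n)⁻¹])
      (δ := ENNReal.ofReal (1 / ((n : ℝ) + 1)))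
      (by simpa using (by positivity : (0 : ℝ) < n + 1))
    exact ⟨⟨A, hA, hAs⟩, Set.subset_union_left.trans hsub,
      (Set.subset_union_left.trans Set.subset_union_right).trans hsub, hA0, h⟩
  choose next hnext hC h0 hinv using step
  -- Starting from the empty set at stage 0 makes every A n, including A 0, an output of `next n`,
  -- hence almost invariant under C n.
  let A : ℕ → {D : Set M // IsCompact D ∧ D⁻¹ = D} := fun n =>
    Nat.rec (next 0 ⟨∅, isCompact_empty, Set.inv_empty⟩) (fun k D => next (k + 1) D) n
  have hA : ∀ n, ∃ D, A n = next n D := by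
    intro n
    cases n with
    | zero => exact ⟨_, rfl⟩
    | succ k => exact ⟨A k, rfl⟩
  refine ⟨fun n => (A n).1, ⟨fun n => (A n).2.1, ?_, fun n => (A n).2.2, ?_, fun n => ?_, ?_⟩⟩
  · exact monotone_nat_of_le_succ fun n => hnext (n + 1) (A n)
  · refine Set.eq_univ_of_forall fun x => ?_
    obtain ⟨n, hn⟩ := C.exists_mem x
    obtain ⟨D, hD⟩ := hA n
    exact Set.mem_iUnion.2 ⟨n, hD ▸ hC n D hn⟩
  · obtain ⟨D, hD⟩ := hA n
    exact pos_iff_ne_zero.2 (hD ▸ h0 n D)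
  · intro p q _ hpq K hK
    rw [Metric.tendstoUniformlyOn_iff]
    intro ε hε
    obtain ⟨N, hN⟩ := C.exists_superset_of_isCompact hK
    obtain ⟨N', hN'⟩ := exists_nat_one_div_lt hε
    filter_upwards [eventually_ge_atTop (max N N')] with n hn t ht
    obtain ⟨D, hD⟩ := hA n
    have htC : t ∈ C n := C.subset ((le_max_left _ _).trans hn) (hN ht)
    rw [dist_comm, dist_eq_norm]
    refine (norm_conv_normInd_sub_one_le μ (A n).2.1 (A n).2.2
      (pos_iff_ne_zero.2 (hD ▸ h0 n D)) hpq (by positivity) (hD ▸ hinv n D t htC)).trans_lt ?_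
    refine lt_of_le_of_lt ?_ hN'
    have : (N' : ℝ) ≤ n := by exact_mod_cast (le_max_right _ _).trans hn
    gcongr

end Exhaustion

end PInduced

namespace PInduced

open scoped Pointwise

/-! ### Integration over G through the cross-section. -/

section QuotientMeasure

variable {G : Type*} [Group G] [TopologicalSpace G] [IsTopologicalGroup G]
  [LocallyCompactSpace G] [T2Space G] [SecondCountableTopology G]
  [MeasurableSpace G] [BorelSpace G] {S : Subgroup G} [IsClosed (S : Set G)]

theorem continuous_modRatio : Continuous (modRatio : S → ℝ≥0) :=
  (continuous_modFun.comp continuous_subtype_val).div₀ continuous_modFun modFun_ne_zero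

theorem CrossSection.tau_section_mul (σ : CrossSection S) (x : G ⧸ S) (s : S) :
    σ.tau (σ.toFun x * s) = s := by
  rw [σ.tau_mul, σ.tau_section, one_mul]

theorem CrossSection.mk_section_mul (σ : CrossSection S) (x : G ⧸ S) (s : S) :
    ((σ.toFun x * s : G) : G ⧸ S) = x := by
  rw [QuotientGroup.mk_mul_of_mem _ s.2, σ.mk_toFun]

/-- The set σ(K)C, with C ⊆ S compact of positive measure, is relatively compact because σ(K) is, so
it has finite Haar measure. That measure is the measure of K times a nonzero integral over C. This
gives the σ-finiteness needed for Fubini. -/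
theorem quotientMeasure_lt_top_of_isCompact (σ : CrossSection S)
    (μG : Measure G) [μG.IsHaarMeasure] (μS : Measure S) [μS.IsHaarMeasure]
    {K : Set (G ⧸ S)} (hK : IsCompact K) : quotientMeasure σ μG μS K < ⊤ := by
  have := σ.borelSpace
  obtain ⟨C⟩ : Nonempty (TopologicalSpace.PositiveCompacts S) := inferInstance
  have hC : MeasurableSet (C : Set S) := C.isCompact.measurableSet
  have hR : Measurable fun s : S => (modRatio s : ℝ≥0∞) := measurable_modRatio.coe_nnreal_ennreal
  let E : Set G := {h | (h : G ⧸ S) ∈ K ∧ σ.tau h ∈ (C : Set S)}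
  have hE : MeasurableSet E :=
    (hK.measurableSet.preimage measurable_mk).inter (hC.preimage σ.measurable_tau)
  have hEfin : μG E ≠ ⊤ := by
    have hsub : E ⊆ closure (σ.toFun '' K) * ((↑) '' (C : Set S)) := by
      rintro h ⟨h1, h2⟩
      rw [← σ.section_mul_tau h]
      exact Set.mul_mem_mul (subset_closure ⟨_, h1, rfl⟩) ⟨_, h2, rfl⟩
    refine ne_top_of_le_ne_top ?_ (measure_mono hsub)
    exact ((σ.relCompact K hK).mul (C.isCompact.image continuous_subtype_val)).measure_ne_top
  have hc : ∫⁻ s in C, (modRatio s : ℝ≥0∞) ∂μS ≠ 0 := by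
    have hsupp : (Function.support fun s : S => (modRatio s : ℝ≥0∞)) = Set.univ := by
      ext s
      simp [modRatio_ne_zero]
    rw [← pos_iff_ne_zero, setLIntegral_pos_iff hR, hsupp, Set.univ_inter]
    exact Measure.measure_pos_of_nonempty_interior μS C.interior_nonempty
  have h1 : μG E = quotientMeasure σ μG μS K * ∫⁻ s in C, (modRatio s : ℝ≥0∞) ∂μS := by
    rw [← lintegral_indicator_one hE, lintegral_eq_quotientMeasure σ μG μS
      (measurable_one.indicator hE), mul_comm, ← lintegral_indicator_const hK.measurableSet]
    refine lintegral_congr fun x => ?_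
    have h2 : ∀ s : S, σ.toFun x * s ∈ E ↔ x ∈ K ∧ s ∈ (C : Set S) := fun s => by
      simp [E, σ.tau_section_mul, σ.mk_section_mul]
    by_cases hx : x ∈ K
    · rw [Set.indicator_of_mem hx, ← lintegral_indicator hC]
      refine lintegral_congr fun s => ?_
      by_cases hs : s ∈ (C : Set S) <;> simp [Set.indicator, h2, hx, hs]
    · simp [Set.indicator, h2, hx]
  refine lt_top_iff_ne_top.2 fun htop => hEfin ?_
  rw [h1, htop, ENNReal.top_mul hc]

theorem isFiniteMeasureOnCompacts_quotientMeasure (σ : CrossSection S)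
    (μG : Measure G) [μG.IsHaarMeasure] (μS : Measure S) [μS.IsHaarMeasure] :
    IsFiniteMeasureOnCompacts (quotientMeasure σ μG μS) :=
  ⟨fun _ hK => quotientMeasure_lt_top_of_isCompact σ μG μS hK⟩

theorem sigmaFinite_quotientMeasure (σ : CrossSection S)
    (μG : Measure G) [μG.IsHaarMeasure] (μS : Measure S) [μS.IsHaarMeasure] :
    SigmaFinite (quotientMeasure σ μG μS) := by
  have := σ.borelSpace
  have := isFiniteMeasureOnCompacts_quotientMeasure σ μG μS
  infer_instance

theorem CrossSection.measurable_section_mul (σ : CrossSection S) :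
    Measurable fun z : (G ⧸ S) × S => σ.toFun z.1 * z.2 :=
  (σ.measurable.comp measurable_fst).mul (measurable_subtype_coe.comp measurable_snd)

/-- Haar measure on `G` as the image of a product measure under `(x, s) ↦ σ(x) s`. -/
theorem map_section_mul_eq (σ : CrossSection S)
    (μG : Measure G) [μG.IsHaarMeasure] (μS : Measure S) [μS.IsHaarMeasure] :
    ((quotientMeasure σ μG μS).prod (μS.withDensity fun s => (modRatio s : ℝ≥0∞))).map
      (fun z => σ.toFun z.1 * z.2) = μG := by
  have hR : Measurable fun s : S => (modRatio s : ℝ≥0∞) := measurable_modRatio.coe_nnreal_ennreal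
  refine Measure.ext_of_lintegral _ fun f hf => ?_
  have hm : Measurable fun z : (G ⧸ S) × S => f (σ.toFun z.1 * z.2) :=
    hf.comp σ.measurable_section_mul
  rw [lintegral_map hf σ.measurable_section_mul, lintegral_prod _ hm.aemeasurable,
    lintegral_eq_quotientMeasure σ μG μS hf]
  refine lintegral_congr fun x => ?_
  rw [lintegral_withDensity_eq_lintegral_mul _ hR
    (show Measurable fun s : S => f (σ.toFun x * s) from hm.comp measurable_prodMk_left)]
  refine lintegral_congr fun s => ?_
  simp only [Pi.mul_apply]
  rw [mul_comm]

theorem integrable_iff_integrable_section_mul (σ : CrossSection S)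
    (μG : Measure G) [μG.IsHaarMeasure] (μS : Measure S) [μS.IsHaarMeasure]
    {f : G → ℂ} (hf : Measurable f) :
    Integrable f μG ↔ Integrable (fun z : (G ⧸ S) × S => f (σ.toFun z.1 * z.2))
      ((quotientMeasure σ μG μS).prod (μS.withDensity fun s => (modRatio s : ℝ≥0∞))) := by
  conv_lhs => rw [← map_section_mul_eq σ μG μS]
  exact integrable_map_measure hf.aestronglyMeasurable σ.measurable_section_mul.aemeasurable

theorem integral_eq_quotientMeasure (σ : CrossSection S)
    (μG : Measure G) [μG.IsHaarMeasure] (μS : Measure S) [μS.IsHaarMeasure]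
    {f : G → ℂ} (hf : Measurable f) (hfi : Integrable f μG) :
    ∫ g, f g ∂μG =
      ∫ x, ∫ s : S, (modRatio s : ℂ) * f (σ.toFun x * s) ∂μS ∂(quotientMeasure σ μG μS) := by
  have := sigmaFinite_quotientMeasure σ μG μS
  conv_lhs => rw [← map_section_mul_eq σ μG μS]
  rw [integral_map σ.measurable_section_mul.aemeasurable hf.aestronglyMeasurable,
    integral_prod _ ((integrable_iff_integrable_section_mul σ μG μS hf).1 hfi)]
  congr 1
  ext x
  rw [integral_withDensity_eq_integral_smul measurable_modRatio]
  rfl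

theorem integrable_fiber_integral (σ : CrossSection S)
    (μG : Measure G) [μG.IsHaarMeasure] (μS : Measure S) [μS.IsHaarMeasure]
    {f : G → ℂ} (hf : Measurable f) (hfi : Integrable f μG) :
    Integrable (fun x => ∫ s : S, (modRatio s : ℂ) * f (σ.toFun x * s) ∂μS)
      (quotientMeasure σ μG μS) := by
  have := sigmaFinite_quotientMeasure σ μG μS
  have h := ((integrable_iff_integrable_section_mul σ μG μS hf).1 hfi).integral_prod_left
  simp_rw [integral_withDensity_eq_integral_smul measurable_modRatio] at h
  exact h

end QuotientMeasure

/-! ### Covariance and the factorization of the integrand. -/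

section Covariance

variable {G : Type*} [Group G] [TopologicalSpace G] [IsTopologicalGroup G]
  [LocallyCompactSpace G] [T2Space G] [SecondCountableTopology G]
  [MeasurableSpace G] [BorelSpace G] {S : Subgroup G} [IsClosed (S : Set G)]

theorem covExt_mul {V : Type*} [AddCommGroup V] [Module ℂ V] (σ : CrossSection S)
    (ρ : Representation ℂ S V) (p : ℝ≥0∞) (ξ : G ⧸ S → V) (g : G) (s : S) :
    covExt σ ρ p ξ (g * s) =
      (((modRatio s : ℝ) ^ (-(p⁻¹).toReal) : ℝ) : ℂ) • ρ s⁻¹ (covExt σ ρ p ξ g) := by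
  simp only [covExt, σ.tau_mul, modRatio_mul, QuotientGroup.mk_mul_of_mem g s.2, map_smul,
    smul_smul, mul_inv_rev, map_mul, Module.End.mul_apply, NNReal.coe_mul]
  rw [Real.mul_rpow (by positivity) (by positivity), Complex.ofReal_mul, mul_comm (Complex.ofReal _)]

theorem covExt_section {V : Type*} [AddCommGroup V] [Module ℂ V] (σ : CrossSection S)
    (ρ : Representation ℂ S V) (p : ℝ≥0∞) (ξ : G ⧸ S → V) (x : G ⧸ S) :
    covExt σ ρ p ξ (σ.toFun x) = ξ x := by
  have h : modRatio (1 : S) = 1 := by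
    have := modRatio_mul (1 : S) 1
    rw [mul_one] at this
    exact (mul_eq_left₀ (modRatio_ne_zero _)).1 this.symm
  simp [covExt, σ.tau_section, σ.mk_toFun, h]

variable {X : Type*} [NormedAddCommGroup X] [NormedSpace ℂ X] {ρ : Representation ℂ S X}

theorem DualPairing.toDual_rep₀_apply (P : DualPairing ρ) (s : S) (v : P.X₀) (x : X) :
    P.toDual (P.rep₀ s v) (ρ s x) = P.toDual v x := P.pair_inv s x v

/-- The operators ρ(s⁻¹) cancel by invariance of the pairing, and the conjugate exponents add up to
one full power of the modular ratio. -/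
theorem toDual_covExt_mul (P : DualPairing ρ) (σ : CrossSection S) {p q : ℝ≥0∞}
    (hpq : p.HolderConjugate q) (ξ : G ⧸ S → X) (η : G ⧸ S → P.X₀) (g h : G) (s : S) :
    P.toDual (covExt σ P.rep₀ q η (h * s)) (covExt σ ρ p ξ (g * (h * s))) =
      (((modRatio s : ℝ)⁻¹ : ℝ) : ℂ) *
        P.toDual (covExt σ P.rep₀ q η h) (covExt σ ρ p ξ (g * h)) := by
  have hs : 0 < (modRatio s : ℝ) := NNReal.coe_pos.2 (pos_iff_ne_zero.2 (modRatio_ne_zero s))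
  rw [← mul_assoc g h, covExt_mul, covExt_mul, map_smul, map_smulₛₗ,
    _root_.smul_apply, P.toDual_rep₀_apply, smul_eq_mul, smul_eq_mul,
    Complex.conj_ofReal, ← mul_assoc, ← Complex.ofReal_mul,
    rpow_mul_rpow_of_holderConjugate hpq hs]

/-- The integrand of the pairing of two twisted tensor products. -/
theorem toDual_twistedTensor (P : DualPairing ρ) (σ : CrossSection S) {p q : ℝ≥0∞}
    (hpq : p.HolderConjugate q) (ξ : G ⧸ S → X) (η : G ⧸ S → P.X₀) (φ ψ : S → ℂ) (g h : G) :
    P.toDual (twistedTensor σ P.rep₀ q η ψ h) (leftReg g (twistedTensor σ ρ p ξ φ) h) =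
      starRingEnd ℂ (ψ (σ.tau h)) *
        (φ (σ.tau (g⁻¹ * σ.toFun (h : G ⧸ S)) * σ.tau h) *
          ((((modRatio (σ.tau h) : ℝ)⁻¹ : ℝ) : ℂ) *
            P.toDual (η (h : G ⧸ S)) (inducedRep σ ρ p g ξ (h : G ⧸ S)))) := by
  -- Decomposing h as σ(hS)τ(h) reduces the covariant extensions to their values on the section.
  have h1 := toDual_covExt_mul P σ hpq ξ η g⁻¹ (σ.toFun (h : G ⧸ S)) (σ.tau h)
  rw [σ.section_mul_tau, covExt_section] at h1
  rw [leftReg, twistedTensor, twistedTensor, LinearMap.map_smulₛₗ, map_smul, _root_.smul_apply,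
    h1, ← σ.tau_mul, mul_assoc g⁻¹, σ.section_mul_tau, smul_eq_mul, smul_eq_mul, inducedRep]
  ring

end Covariance

end PInduced

namespace PInduced

open scoped Pointwise

/-! ### The kernel of the matrix coefficient. -/

section Kernel

variable {G : Type*} [Group G] [TopologicalSpace G] [IsTopologicalGroup G]
  [LocallyCompactSpace G] [T2Space G] [SecondCountableTopology G]
  [MeasurableSpace G] [BorelSpace G] {S : Subgroup G} [IsClosed (S : Set G)]
  {X : Type*} [NormedAddCommGroup X] [NormedSpace ℂ X] {ρ : Representation ℂ S X}

/-- The integrand of the pairing of `π_p(g) ξ` with `η`. -/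
noncomputable def coeffKernel (P : DualPairing ρ) (σ : CrossSection S) (p : ℝ≥0∞)
    (ξ : G ⧸ S → X) (η : G ⧸ S → P.X₀) (g : G) (y : G ⧸ S) : ℂ :=
  P.toDual (η y) (inducedRep σ ρ p g ξ y)

theorem coeffKernel_eq (P : DualPairing ρ) (σ : CrossSection S) (p : ℝ≥0∞)
    (ξ : G ⧸ S → X) (η : G ⧸ S → P.X₀) (g : G) (y : G ⧸ S) :
    coeffKernel P σ p ξ η g y =
      (((modRatio (σ.tau (g⁻¹ * σ.toFun y)) : ℝ) ^ (-(p⁻¹).toReal) : ℝ) : ℂ) *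
        P.toDual (η y) (ρ (σ.tau (g⁻¹ * σ.toFun y))⁻¹ (ξ (g⁻¹ * σ.toFun y : G))) := by
  rw [coeffKernel, inducedRep, covExt, map_smul, smul_eq_mul]

/-- Isometry makes the operators equicontinuous, which upgrades strong continuity to joint
continuity. -/
theorem continuous_rep (hρ_iso : ∀ (s : S) (v : X), ‖ρ s v‖ = ‖v‖)
    (hρ_cont : ∀ v : X, Continuous fun s : S => ρ s v) :
    Continuous fun z : S × X => ρ z.1 z.2 := by
  refine continuous_iff_continuousAt.2 fun z₀ => ?_
  rw [ContinuousAt, tendsto_iff_norm_sub_tendsto_zero]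
  have h1 : Tendsto (fun z : S × X => ‖z.2 - z₀.2‖ + ‖ρ z.1 z₀.2 - ρ z₀.1 z₀.2‖) (𝓝 z₀) (𝓝 0) := by
    have h : Continuous fun z : S × X => ‖z.2 - z₀.2‖ + ‖ρ z.1 z₀.2 - ρ z₀.1 z₀.2‖ :=
      (continuous_snd.sub continuous_const).norm.add
        (((hρ_cont z₀.2).comp continuous_fst).sub continuous_const).norm
    simpa using h.tendsto z₀
  refine squeeze_zero (fun _ => norm_nonneg _) (fun z => ?_) h1
  calc ‖ρ z.1 z.2 - ρ z₀.1 z₀.2‖ = ‖ρ z.1 (z.2 - z₀.2) + (ρ z.1 z₀.2 - ρ z₀.1 z₀.2)‖ := by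
        rw [map_sub, sub_add_sub_cancel]
    _ ≤ ‖z.2 - z₀.2‖ + ‖ρ z.1 z₀.2 - ρ z₀.1 z₀.2‖ := by
        refine (norm_add_le _ _).trans_eq ?_
        rw [hρ_iso]

theorem measurable_coeffKernel (P : DualPairing ρ) (σ : CrossSection S) (p : ℝ≥0∞)
    {ξ : G ⧸ S → X} {η : G ⧸ S → P.X₀} (hρ_iso : ∀ (s : S) (v : X), ‖ρ s v‖ = ‖v‖)
    (hρ_cont : ∀ v : X, Continuous fun s : S => ρ s v) (hξ : Continuous ξ)
    (hη : Continuous fun x => P.toDual (η x)) (g : G) :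
    Measurable (coeffKernel P σ p ξ η g) := by
  have := σ.borelSpace
  -- X need not be separable, so measurability goes through a continuous scalar function on a second
  -- countable space, composed with Borel maps into that space.
  have hΨ : Continuous fun z : (G ⧸ S) × S × (G ⧸ S) => P.toDual (η z.1) (ρ z.2.1 (ξ z.2.2)) :=
    (hη.comp continuous_fst).clm_apply ((continuous_rep hρ_iso hρ_cont).comp
      (continuous_snd.fst.prodMk (hξ.comp continuous_snd.snd)))
  have hm : Measurable fun y : G ⧸ S => g⁻¹ * σ.toFun y := σ.measurable.const_mul _
  have ht : Measurable fun y : G ⧸ S => σ.tau (g⁻¹ * σ.toFun y) := σ.measurable_tau.comp hm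
  have heq : coeffKernel P σ p ξ η g = fun y =>
      (((modRatio (σ.tau (g⁻¹ * σ.toFun y)) : ℝ) ^ (-(p⁻¹).toReal) : ℝ) : ℂ) *
        P.toDual (η y) (ρ (σ.tau (g⁻¹ * σ.toFun y))⁻¹ (ξ (g⁻¹ * σ.toFun y : G))) :=
    funext fun y => coeffKernel_eq P σ p ξ η g y
  rw [heq]
  refine Measurable.mul ?_ (hΨ.measurable.comp
    (measurable_id.prodMk (ht.inv.prodMk (measurable_mk.comp hm))))
  exact Complex.measurable_ofReal.comp
    ((measurable_modRatio.comp ht).coe_nnreal_real.pow_const _)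

/-- The kernel is bounded on compact sets, and lives over compact sets. -/
theorem exists_coeffKernel_bound (P : DualPairing ρ) (σ : CrossSection S) (p : ℝ≥0∞)
    {ξ : G ⧸ S → X} {η : G ⧸ S → P.X₀} (hρ_iso : ∀ (s : S) (v : X), ‖ρ s v‖ = ‖v‖)
    (hξ : Continuous ξ) (hξc : HasCompactSupport ξ)
    (hη : Continuous fun x => P.toDual (η x)) (hηc : HasCompactSupport η)
    {Q : Set G} (hQ : IsCompact Q) :
    ∃ (T : Set S) (B : ℝ), IsCompact T ∧ 0 ≤ B ∧ ∀ g ∈ Q, ∀ y,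
      ‖coeffKernel P σ p ξ η g y‖ ≤ (tsupport η).indicator (fun _ => B) y ∧
      (coeffKernel P σ p ξ η g y ≠ 0 → σ.tau (g⁻¹ * σ.toFun y) ∈ T) := by
  -- With x = g⁻¹σ(y)S one has τ(g⁻¹σ(y)) = σ(x)⁻¹ g⁻¹ σ(y), and a nonzero kernel forces x ∈ supp ξ
  -- and y ∈ supp η.
  let T₀ : Set G := (closure (σ.toFun '' tsupport ξ))⁻¹ *
    (Q⁻¹ * closure (σ.toFun '' tsupport η))
  have hT₀ : IsCompact T₀ := (σ.relCompact _ hξc).inv.mul (hQ.inv.mul (σ.relCompact _ hηc))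
  let T : Set S := (↑) ⁻¹' T₀
  have hT : IsCompact T :=
    (‹IsClosed (S : Set G)›.isClosedEmbedding_subtypeVal).isCompact_preimage hT₀
  have hηc' : HasCompactSupport fun x => P.toDual (η x) :=
    hηc.comp_left (g := fun v => P.toDual v) (map_zero _)
  obtain ⟨B₁, hB₁⟩ := hηc'.exists_bound_of_continuous hη
  obtain ⟨B₂, hB₂⟩ := hξc.exists_bound_of_continuous hξ
  have hcont : Continuous fun s : S => (modRatio s : ℝ) ^ (-(p⁻¹).toReal) :=
    (NNReal.continuous_coe.comp continuous_modRatio).rpow_const fun s =>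
      Or.inl (NNReal.coe_ne_zero.2 (modRatio_ne_zero s))
  obtain ⟨B₃, hB₃⟩ := hT.exists_bound_of_continuousOn hcont.continuousOn
  have hmem : ∀ g ∈ Q, ∀ y, coeffKernel P σ p ξ η g y ≠ 0 →
      y ∈ tsupport η ∧ σ.tau (g⁻¹ * σ.toFun y) ∈ T := by
    intro g hg y hne
    rw [coeffKernel_eq] at hne
    have hy : y ∈ tsupport η := by
      refine subset_tsupport _ fun h => hne ?_
      simp [h]
    have hx : ((g⁻¹ * σ.toFun y : G) : G ⧸ S) ∈ tsupport ξ := by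
      refine subset_tsupport _ fun h => hne ?_
      simp [h]
    refine ⟨hy, ?_⟩
    exact Set.mul_mem_mul (Set.inv_mem_inv.2 (subset_closure ⟨_, hx, rfl⟩))
      (Set.mul_mem_mul (Set.inv_mem_inv.2 hg) (subset_closure ⟨_, hy, rfl⟩))
  refine ⟨T, |B₃| * (|B₁| * |B₂|), hT, by positivity, fun g hg y => ⟨?_, fun h => (hmem g hg y h).2⟩⟩
  by_cases hne : coeffKernel P σ p ξ η g y = 0
  · rw [hne, norm_zero]
    exact Set.indicator_nonneg (fun _ _ => by positivity) _
  · obtain ⟨hy, ht⟩ := hmem g hg y hne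
    rw [Set.indicator_of_mem hy, coeffKernel_eq, norm_mul, Complex.norm_real]
    gcongr
    · exact (hB₃ _ ht).trans (le_abs_self _)
    · refine (ContinuousLinearMap.le_opNorm _ _).trans ?_
      rw [hρ_iso]
      gcongr
      · exact (hB₁ y).trans (le_abs_self _)
      · exact (hB₂ _).trans (le_abs_self _)

theorem measurableSet_tsupport_quotient (σ : CrossSection S) {V : Type*} [Zero V]
    (η : G ⧸ S → V) : MeasurableSet (tsupport η) := by
  have := σ.borelSpace
  exact (isClosed_tsupport η).measurableSet

theorem integrable_indicator_tsupport (σ : CrossSection S)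
    (μG : Measure G) [μG.IsHaarMeasure] (μS : Measure S) [μS.IsHaarMeasure] {V : Type*} [Zero V]
    {η : G ⧸ S → V} (hηc : HasCompactSupport η) (B : ℝ) :
    Integrable ((tsupport η).indicator fun _ => B) (quotientMeasure σ μG μS) :=
  (integrable_indicator_iff (measurableSet_tsupport_quotient σ η)).2
    (integrableOn_const (quotientMeasure_lt_top_of_isCompact σ μG μS hηc).ne)

theorem integrable_coeffKernel (P : DualPairing ρ) (σ : CrossSection S) (p : ℝ≥0∞)
    (μG : Measure G) [μG.IsHaarMeasure] (μS : Measure S) [μS.IsHaarMeasure]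
    {ξ : G ⧸ S → X} {η : G ⧸ S → P.X₀} (hρ_iso : ∀ (s : S) (v : X), ‖ρ s v‖ = ‖v‖)
    (hρ_cont : ∀ v : X, Continuous fun s : S => ρ s v)
    (hξ : Continuous ξ) (hξc : HasCompactSupport ξ)
    (hη : Continuous fun x => P.toDual (η x)) (hηc : HasCompactSupport η) (g : G) :
    Integrable (coeffKernel P σ p ξ η g) (quotientMeasure σ μG μS) := by
  obtain ⟨T, B, -, -, hB⟩ := exists_coeffKernel_bound P σ p hρ_iso hξ hξc hη hηc
    (isCompact_singleton (x := g))
  refine (integrable_indicator_tsupport σ μG μS hηc B).mono'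
    (measurable_coeffKernel P σ p hρ_iso hρ_cont hξ hη g).aestronglyMeasurable
    (ae_of_all _ fun y => (hB g rfl y).1)

theorem measurable_normInd {M : Type*} [MeasurableSpace M] (μ : Measure M) (p : ℝ≥0∞) {A : Set M}
    (hA : MeasurableSet A) : Measurable (normInd μ p A) :=
  measurable_const.indicator hA

theorem norm_normInd_le {M : Type*} [MeasurableSpace M] (μ : Measure M) (p : ℝ≥0∞) (A : Set M)
    (s : M) : ‖normInd μ p A s‖ ≤ μ.real A ^ (-(p⁻¹).toReal) := by
  have h : 0 ≤ μ.real A ^ (-(p⁻¹).toReal) := by positivity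
  by_cases hs : s ∈ A
  · rw [normInd, Set.indicator_of_mem hs, Complex.norm_real, Real.norm_of_nonneg h]
  · rwa [normInd, Set.indicator_of_notMem hs, norm_zero]

theorem conj_normInd {M : Type*} [MeasurableSpace M] (μ : Measure M) (p : ℝ≥0∞) (A : Set M)
    (s : M) : starRingEnd ℂ (normInd μ p A s) = normInd μ p A s := by
  by_cases hs : s ∈ A
  · rw [normInd, Set.indicator_of_mem hs, Complex.conj_ofReal]
  · rw [normInd, Set.indicator_of_notMem hs, map_zero]

theorem normInd_inv {M : Type*} [Group M] [MeasurableSpace M] (μ : Measure M) (p : ℝ≥0∞)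
    {A : Set M} (hsymm : (fun s => s⁻¹) ⁻¹' A = A) (s : M) :
    normInd μ p A s⁻¹ = normInd μ p A s := by
  have : s⁻¹ ∈ A ↔ s ∈ A := by
    conv_rhs => rw [← hsymm]
    rfl
  by_cases hs : s ∈ A
  · rw [normInd, Set.indicator_of_mem hs, Set.indicator_of_mem (this.2 hs)]
  · rw [normInd, Set.indicator_of_notMem hs, Set.indicator_of_notMem fun h => hs (this.1 h)]

/-- The fibre integral produces the factors in the order q, p. The exhaustion property cannot be
applied in that order when p = 1, since its first exponent must be finite. -/
theorem conv_normInd_comm {M : Type*} [Group M] [TopologicalSpace M] [IsTopologicalGroup M]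
    [LocallyCompactSpace M] [T2Space M] [SecondCountableTopology M]
    [MeasurableSpace M] [BorelSpace M] (μ : Measure M) [μ.IsHaarMeasure]
    {A : Set M} (hA : IsCompact A) (hsymm : (fun s => s⁻¹) ⁻¹' A = A)
    (hA0 : 0 < μ A) {p q : ℝ≥0∞} (hpq : p.HolderConjugate q) :
    conv μ (normInd μ q A) (normInd μ p A) = conv μ (normInd μ p A) (normInd μ q A) := by
  ext t
  rw [conv_normInd μ hA hsymm hA0 hpq, conv_normInd μ hA hsymm hA0 hpq.symm]

/-! ### Pairings of twisted tensors with normalized indicators. -/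

section Tensor

variable (P : DualPairing ρ) (σ : CrossSection S) {p q : ℝ≥0∞}
  (μG : Measure G) [μG.IsHaarMeasure] (μS : Measure S)
  [μS.IsHaarMeasure] {ξ : G ⧸ S → X} {η : G ⧸ S → P.X₀}

/-- The integrand of the pairing of twisted tensor products with normalized indicators. -/
noncomputable def tensorKernel (p q : ℝ≥0∞) (ξ : G ⧸ S → X) (η : G ⧸ S → P.X₀) (A : Set S)
    (g h : G) : ℂ :=
  P.toDual (twistedTensor σ P.rep₀ q η (normInd μS q A) h)
    (leftReg g (twistedTensor σ ρ p ξ (normInd μS p A)) h)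

theorem tensorKernel_eq (hpq : p.HolderConjugate q) (A : Set S) (g h : G) :
    tensorKernel P σ μS p q ξ η A g h = normInd μS q A (σ.tau h) *
      (normInd μS p A (σ.tau (g⁻¹ * σ.toFun (h : G ⧸ S)) * σ.tau h) *
        ((((modRatio (σ.tau h) : ℝ)⁻¹ : ℝ) : ℂ) * coeffKernel P σ p ξ η g (h : G ⧸ S))) := by
  rw [tensorKernel, toDual_twistedTensor P σ hpq, conj_normInd]
  rfl

theorem tensorKernel_section_mul (hpq : p.HolderConjugate q) (A : Set S) (g : G) (y : G ⧸ S) (s : S) :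
    tensorKernel P σ μS p q ξ η A g (σ.toFun y * s) = normInd μS q A s *
      (normInd μS p A (σ.tau (g⁻¹ * σ.toFun y) * s) *
        ((((modRatio s : ℝ)⁻¹ : ℝ) : ℂ) * coeffKernel P σ p ξ η g y)) := by
  rw [tensorKernel_eq P σ μS hpq, σ.tau_section_mul, σ.mk_section_mul]

theorem measurable_tensorKernel (hpq : p.HolderConjugate q) (hρ_iso : ∀ (s : S) (v : X), ‖ρ s v‖ = ‖v‖)
    (hρ_cont : ∀ v : X, Continuous fun s : S => ρ s v) (hξ : Continuous ξ)
    (hη : Continuous fun x => P.toDual (η x)) {A : Set S} (hA : MeasurableSet A) (g : G) :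
    Measurable (tensorKernel P σ μS p q ξ η A g) := by
  have heq := funext (tensorKernel_eq P σ μS hpq (ξ := ξ) (η := η) A g)
  rw [heq]
  have hτ := σ.measurable_tau
  have hm : Measurable fun h : G => σ.tau (g⁻¹ * σ.toFun (h : G ⧸ S)) :=
    hτ.comp ((σ.measurable.comp measurable_mk).const_mul _)
  refine ((measurable_normInd μS q hA).comp hτ).mul
    (((measurable_normInd μS p hA).comp (hm.mul hτ)).mul (Measurable.mul ?_ ?_))
  · exact Complex.measurable_ofReal.comp (measurable_modRatio.comp hτ).coe_nnreal_real.inv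
  · exact (measurable_coeffKernel P σ p hρ_iso hρ_cont hξ hη g).comp measurable_mk

theorem integrable_tensorKernel (hpq : p.HolderConjugate q) (hρ_iso : ∀ (s : S) (v : X), ‖ρ s v‖ = ‖v‖)
    (hρ_cont : ∀ v : X, Continuous fun s : S => ρ s v)
    (hξ : Continuous ξ) (hξc : HasCompactSupport ξ)
    (hη : Continuous fun x => P.toDual (η x)) (hηc : HasCompactSupport η)
    {A : Set S} (hA : IsCompact A) (g : G) :
    Integrable (tensorKernel P σ μS p q ξ η A g) μG := by
  have := sigmaFinite_quotientMeasure σ μG μS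
  have hm := measurable_tensorKernel P σ μS hpq hρ_iso hρ_cont hξ hη hA.measurableSet g
  obtain ⟨T, B, -, hB0, hB⟩ := exists_coeffKernel_bound P σ p hρ_iso hξ hξc hη hηc
    (isCompact_singleton (x := g))
  rw [integrable_iff_integrable_section_mul σ μG μS hm]
  let cp : ℝ := μS.real A ^ (-(p⁻¹).toReal)
  let cq : ℝ := μS.real A ^ (-(q⁻¹).toReal)
  have hcp : 0 ≤ cp := by positivity
  have hcq : 0 ≤ cq := by positivity
  -- The density of the fibre measure cancels the inverse modular ratio, leaving a constant on a
  -- compact set.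
  have hS : Integrable (fun s : S => (modRatio s : ℝ)⁻¹ * A.indicator (fun _ => cq * cp) s)
      (μS.withDensity fun s => (modRatio s : ℝ≥0∞)) := by
    rw [integrable_withDensity_iff_integrable_smul measurable_modRatio]
    have h : Integrable (A.indicator fun _ => cq * cp) μS :=
      (integrable_indicator_iff hA.measurableSet).2 (integrableOn_const hA.measure_ne_top)
    refine h.congr (ae_of_all _ fun s => ?_)
    simp only [NNReal.smul_def, smul_eq_mul]
    rw [mul_inv_cancel_left₀ (NNReal.coe_ne_zero.2 (modRatio_ne_zero s))]
  refine ((integrable_indicator_tsupport σ μG μS hηc B).mul_prod hS).mono'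
    (hm.comp σ.measurable_section_mul).aestronglyMeasurable (ae_of_all _ fun z => ?_)
  rw [tensorKernel_section_mul P σ μS hpq, norm_mul, norm_mul, norm_mul, Complex.norm_real,
    Real.norm_of_nonneg (by positivity)]
  by_cases hs : z.2 ∈ A
  · rw [Set.indicator_of_mem hs]
    calc _ ≤ cq * (cp * ((modRatio z.2 : ℝ)⁻¹ * (tsupport η).indicator (fun _ => B) z.1)) := by
          gcongr
          · exact norm_normInd_le μS q A z.2
          · exact norm_normInd_le μS p A _
          · exact (hB g rfl z.1).1
      _ = _ := by ring
  · rw [Set.indicator_of_notMem hs, normInd, Set.indicator_of_notMem hs]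
    simp

/-- The modular factors cancel, and symmetry of A replaces ts by s⁻¹t⁻¹, which exhibits a
convolution evaluated at t⁻¹. -/
theorem fiber_integral_tensorKernel (hpq : p.HolderConjugate q) {A : Set S} (hsymm : (fun s => s⁻¹) ⁻¹' A = A)
    (g : G) (y : G ⧸ S) :
    ∫ s : S, (modRatio s : ℂ) * tensorKernel P σ μS p q ξ η A g (σ.toFun y * s) ∂μS =
      coeffKernel P σ p ξ η g y *
        conv μS (normInd μS q A) (normInd μS p A) (σ.tau (g⁻¹ * σ.toFun y))⁻¹ := by
  rw [conv, ← integral_const_mul]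
  congr 1
  ext s
  have hs : (modRatio s : ℂ) * (((modRatio s : ℝ)⁻¹ : ℝ) : ℂ) = 1 := by
    rw [Complex.ofReal_inv]
    exact mul_inv_cancel₀ (Complex.ofReal_ne_zero.2 (NNReal.coe_ne_zero.2 (modRatio_ne_zero s)))
  rw [tensorKernel_section_mul P σ μS hpq, ← normInd_inv μS p hsymm (_ * s), mul_inv_rev]
  linear_combination (coeffKernel P σ p ξ η g y * normInd μS q A s *
    normInd μS p A (s⁻¹ * (σ.tau (g⁻¹ * σ.toFun y))⁻¹)) * hs

/-- After fibre integration the difference is the integral of the kernel times (convolution - 1), so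
control of the convolution is needed only where the kernel is nonzero. -/
theorem norm_integral_tensorKernel_sub_le (hpq : p.HolderConjugate q) (hρ_iso : ∀ (s : S) (v : X), ‖ρ s v‖ = ‖v‖)
    (hρ_cont : ∀ v : X, Continuous fun s : S => ρ s v)
    (hξ : Continuous ξ) (hξc : HasCompactSupport ξ)
    (hη : Continuous fun x => P.toDual (η x)) (hηc : HasCompactSupport η)
    {A : Set S} (hA : IsCompact A) (hsymm : (fun s => s⁻¹) ⁻¹' A = A) {g : G} {B ε : ℝ}
    (hε : 0 ≤ ε)
    (hB : ∀ y, ‖coeffKernel P σ p ξ η g y‖ ≤ (tsupport η).indicator (fun _ => B) y)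
    (hconv : ∀ y, coeffKernel P σ p ξ η g y ≠ 0 →
      ‖conv μS (normInd μS q A) (normInd μS p A) (σ.tau (g⁻¹ * σ.toFun y))⁻¹ - 1‖ ≤ ε) :
    ‖∫ h, tensorKernel P σ μS p q ξ η A g h ∂μG -
      ∫ y, coeffKernel P σ p ξ η g y ∂(quotientMeasure σ μG μS)‖ ≤
        (∫ y, (tsupport η).indicator (fun _ => B) y ∂(quotientMeasure σ μG μS)) * ε := by
  have hm := measurable_tensorKernel P σ μS hpq hρ_iso hρ_cont hξ hη hA.measurableSet g
  have hi := integrable_tensorKernel P σ μG μS hpq hρ_iso hρ_cont hξ hξc hη hηc hA g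
  have hif := integrable_fiber_integral σ μG μS hm hi
  rw [integral_eq_quotientMeasure σ μG μS hm hi,
    ← integral_sub hif (integrable_coeffKernel P σ p μG μS hρ_iso hρ_cont hξ hξc hη hηc g),
    ← integral_mul_const]
  refine norm_integral_le_of_norm_le
    ((integrable_indicator_tsupport σ μG μS hηc B).mul_const ε) (ae_of_all _ fun y => ?_)
  rw [fiber_integral_tensorKernel P σ μS hpq hsymm, ← mul_sub_one, norm_mul]
  by_cases h0 : coeffKernel P σ p ξ η g y = 0
  · rw [h0, norm_zero, zero_mul]
    exact mul_nonneg ((norm_nonneg _).trans (hB y)) hε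
  · exact mul_le_mul (hB y) (hconv y h0) (norm_nonneg _) ((norm_nonneg _).trans (hB y))

end Tensor

end Kernel

end PInduced

theorem proposition3p3
    {G : Type*} [Group G] [TopologicalSpace G] [IsTopologicalGroup G]
    [LocallyCompactSpace G] [T2Space G] [SecondCountableTopology G]
    [MeasurableSpace G] [BorelSpace G]
    (S : Subgroup G) [IsClosed (S : Set G)] (hS : PInduced.IsAmenable S)
    (μG : Measure G) [μG.IsHaarMeasure] (μS : Measure S) [μS.IsHaarMeasure]
    (σ : PInduced.CrossSection S)
    {X : Type*} [NormedAddCommGroup X] [NormedSpace ℂ X] [CompleteSpace X]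
    (ρ : Representation ℂ S X) (hρ_iso : ∀ (s : S) (v : X), ‖ρ s v‖ = ‖v‖)
    (hρ_cont : ∀ v : X, Continuous fun s : S => ρ s v)
    (P : PInduced.DualPairing ρ)
    (p q : ℝ≥0∞) (hp : p ≠ ⊤) (hpq : p.HolderConjugate q)
    (ξ η : G ⧸ S → P.X₀)
    (hξ : Continuous ξ) (hξc : HasCompactSupport ξ)
    (hη : Continuous η) (hηc : HasCompactSupport η)
    (hη' : Continuous fun x => P.toDual (η x)) :
    (∃ A : ℕ → Set S, PInduced.IsExhaustion μS A) ∧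
    ∀ A : ℕ → Set S, PInduced.IsExhaustion μS A →
      (∀ g : G, P.Pairable (PInduced.quotientMeasure σ μG μS)
        (PInduced.inducedRep σ ρ p g (fun x => (ξ x : X))) η) ∧
      (∀ (j : ℕ) (g : G), P.Pairable μG
        (PInduced.leftReg g
          (PInduced.twistedTensor σ ρ p (fun x => (ξ x : X)) (PInduced.normInd μS p (A j))))
        (PInduced.twistedTensor σ P.rep₀ q η (PInduced.normInd μS q (A j)))) ∧
      ∀ Q : Set G, IsCompact Q →
        TendstoUniformlyOn
          (fun (j : ℕ) (g : G) => P.pair μG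
            (PInduced.leftReg g
              (PInduced.twistedTensor σ ρ p (fun x => (ξ x : X)) (PInduced.normInd μS p (A j))))
            (PInduced.twistedTensor σ P.rep₀ q η (PInduced.normInd μS q (A j))))
          (fun g : G => P.pair (PInduced.quotientMeasure σ μG μS)
            (PInduced.inducedRep σ ρ p g (fun x => (ξ x : X))) η)
          atTop Q := by
  have hξ' : Continuous fun x => (ξ x : X) := continuous_subtype_val.comp hξ
  have hξc' : HasCompactSupport fun x => (ξ x : X) :=
    hξc.comp_left (g := fun v : P.X₀ => (v : X)) rfl
  refine ⟨PInduced.exists_isExhaustion μS hS, fun A hA => ⟨fun g => ?_, fun j g => ?_, ?_⟩⟩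
  · exact PInduced.integrable_coeffKernel P σ p μG μS hρ_iso hρ_cont hξ' hξc' hη' hηc g
  · exact PInduced.integrable_tensorKernel P σ μG μS hpq hρ_iso hρ_cont hξ' hξc' hη' hηc
      (hA.isCompact j) g
  · intro Q hQ
    obtain ⟨T, B, hT, -, hB⟩ :=
      PInduced.exists_coeffKernel_bound P σ p hρ_iso hξ' hξc' hη' hηc hQ
    let I : ℝ := ∫ y, (tsupport η).indicator (fun _ => B) y ∂(PInduced.quotientMeasure σ μG μS)
    rw [Metric.tendstoUniformlyOn_iff]
    intro ε hε
    -- The added 1 avoids division by zero when I = 0 and makes the final inequality strict.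
    have hδ : 0 < ε / (|I| + 1) := by positivity
    -- The convolution is evaluated at τ(g⁻¹σ(y))⁻¹, hence the inverse of T.
    have hconv := Metric.tendstoUniformlyOn_iff.1 (hA.tendsto p q hp hpq T⁻¹ hT.inv) _ hδ
    filter_upwards [hconv] with j hj g hg
    rw [dist_comm, dist_eq_norm]
    refine (PInduced.norm_integral_tensorKernel_sub_le P σ μG μS hpq hρ_iso hρ_cont hξ' hξc' hη'
      hηc (hA.isCompact j) (hA.symm j) hδ.le (fun y => (hB g hg y).1) fun y hy => ?_).trans_lt ?_
    · rw [PInduced.conv_normInd_comm μS (hA.isCompact j) (hA.symm j) (hA.pos j) hpq,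
        ← dist_eq_norm, dist_comm]
      exact (hj _ (Set.inv_mem_inv.2 ((hB g hg y).2 hy))).le
    · calc I * (ε / (|I| + 1)) ≤ |I| * (ε / (|I| + 1)) := by
            gcongr
            exact le_abs_self I
        _ < ε := by
            rw [← mul_div_assoc, div_lt_iff₀ (by positivity)]
            nlinarith
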